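/- Let $G$ be a locally compact (Hausdorff) group with left Haar measure $\nu$, and let $\mathcal L:G\to[0,\infty)$ be a length function, i.e. a Borel function with $\mathcal L(e)=0$, $\mathcal L(s^{-1})=\mathcal L(s)$ and $\mathcal L(st)\le \mathcal L(s)+\mathcal L(t)$ for all $s,t\in G$. For $d\ge 0$ put $\omega_d(s)=(1+\mathcal L(s))^d$, and for $1\le r<\infty$ let $L^r(G,\omega_d)$ be the space of (classes of) functions $f$ with $\|f\|_{L^r(G,\omega_d)}:=\|f\omega_d\|_{L^r(G)}<\infty$; it contains $C_c(G)$. For $1\le r\le\infty$ and $f\in L^1(G)$ let $\lambda_r(f)\in B(L^r(G))$ be the operator $g\mapsto f*g$, let $C^*_r(G)$ be the norm closure of $\lambda_2(L^1(G))$ in $B(L^2(G))$, and for conjugate exponents $p,q\in[1,\infty]$ let $PF_p^*(G)$ be the completion of $L^1(G)$ in the norm $\max\{\|\lambda_p(f)\|,\|\lambda_q(f)\|\}$. Write $L^2(G,\omega_d)\subseteq C^*_r(G)$ if the canonical inclusion $C_c(G)\subseteq C^*_r(G)$ extends to a bounded linear map $L^2(G,\omega_d)\to C^*_r(G)$. Say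 that $(G,\mathcal L)$ has rapid decay if $L^2(G,\omega_d)\subseteq C_r^*(G)$ for some $d>0$, and in that case put $rd(G)=\inf\{d\ge 0: L^2(G,\omega_d)\subseteq C^*_r(G)\}$. **Theorem.** Suppose that $(G,\mathcal L)$ has rapid decay, $1\le q\le p\le\infty$ with $\frac1p+\frac1q=1$, and $d>rd(G)$. Then the convolution product on $C_c(G)$ extends to a bounded (associative) multiplication on $L^q(G,\omega_{2d/p})$ (where $2d/p=0$ if $p=\infty$). Moreover, the canonical inclusion $C_c(G)\subseteq PF_p^*(G)$ extends to an injective bounded linear map $L^q(G,\omega_{2d/p})\to PF_p^*(G)$. -/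

import Mathlib

open MeasureTheory
open scoped ENNReal CompactlySupported

/-- A length function on a topological group: a Borel function `G → [0, ∞)` that is symmetric,
vanishes at the identity and is subadditive. -/
structure LengthFunction (G : Type*) [Group G] [MeasurableSpace G] where
  toFun : G → ℝ
  measurable' : Measurable toFun
  nonneg' : ∀ s, 0 ≤ toFun s
  symm' : ∀ s, toFun s⁻¹ = toFun s
  map_one' : toFun 1 = 0
  map_mul_le' : ∀ s t, toFun (s * t) ≤ toFun s + toFun t

/-- The polynomial weight `ω_d(s) = (1 + L(s))^d`. -/
noncomputable def polyWeight {G : Type*} [Group G] [MeasurableSpace G] (L : LengthFunction G)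
    (d : ℝ) (s : G) : ℝ :=
  (1 + L.toFun s) ^ d

/-- The measure `ω_{rd} dν` (`r` a finite exponent), for which
`L^r(G, ω_d) = L^r(G, ω_{rd} dν)`, so that `‖f‖_{L^r(G, ω_d)} = ‖f ω_d‖_{L^r(G)}`. -/
noncomputable def weightedMeasure {G : Type*} [Group G] [MeasurableSpace G] (μ : Measure G)
    (L : LengthFunction G) (r : ℝ≥0∞) (d : ℝ) : Measure G :=
  μ.withDensity fun s => ENNReal.ofReal (polyWeight L (r.toReal * d) s)

/-- The weighted space `L^r(G, ω_d)` of complex functions, for a finite exponent `r`. -/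
abbrev WeightedLp {G : Type*} [Group G] [MeasurableSpace G] (μ : Measure G)
    (L : LengthFunction G) (r : ℝ≥0∞) (d : ℝ) : Type _ :=
  Lp ℂ r (weightedMeasure μ L r d)

/-- Convolution `(f * g)(s) = ∫ f(t) g(t⁻¹ s) dt` of functions on a group. -/
noncomputable def groupConv {G : Type*} [Group G] [MeasurableSpace G] (μ : Measure G)
    (f g : G → ℂ) (s : G) : ℂ :=
  ∫ t, f t * g (t⁻¹ * s) ∂μ

section LocallyCompact

variable {G : Type*} [Group G] [TopologicalSpace G] [IsTopologicalGroup G]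
  [LocallyCompactSpace G] [T2Space G] [MeasurableSpace G] [BorelSpace G]

/-- A Borel length function on a locally compact group is bounded on compact sets. -/
theorem LengthFunction.exists_bound_of_isCompact (μ : Measure G) [μ.IsHaarMeasure] [μ.Regular]
    (L : LengthFunction G) {K : Set G} (hK : IsCompact K) : ∃ C : ℝ, ∀ s ∈ K, L.toFun s ≤ C := by
  obtain ⟨K₀, hK₀, hK₀1⟩ := exists_compact_mem_nhds (1 : G)
  have hpos : 0 < μ K₀ := Measure.measure_pos_of_mem_nhds μ hK₀1
  have hcov : K₀ = ⋃ n : ℕ, K₀ ∩ {s | L.toFun s ≤ n} := by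
    ext s
    simp only [Set.mem_iUnion, Set.mem_inter_iff, Set.mem_ofPred_eq, exists_and_left]
    exact ⟨fun h => ⟨h, exists_nat_ge _⟩, fun h => h.1⟩
  have hn : ∃ n : ℕ, 0 < μ (K₀ ∩ {s | L.toFun s ≤ n}) := by
    by_contra! h
    have h0 : μ (⋃ n : ℕ, K₀ ∩ {s | L.toFun s ≤ n}) = 0 :=
      measure_iUnion_null fun n => le_antisymm (h n) zero_le
    rw [← hcov] at h0
    exact hpos.ne' h0
  obtain ⟨n, hn⟩ := hn
  have hmeas : MeasurableSet (K₀ ∩ {s | L.toFun s ≤ n}) :=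
    hK₀.measurableSet.inter (measurableSet_le L.measurable' measurable_const)
  have hfin : μ (K₀ ∩ {s | L.toFun s ≤ n}) ≠ ∞ :=
    ((measure_mono Set.inter_subset_left).trans_lt hK₀.measure_lt_top).ne
  have hV := Measure.div_mem_nhds_one_of_haar_pos_ne_top μ _ hmeas hn hfin
  obtain ⟨t, ht⟩ := compact_covered_by_mul_left_translates hK ⟨1, mem_interior_iff_mem_nhds.2 hV⟩
  refine ⟨∑ g ∈ t, L.toFun g + (n + n), fun s hs => ?_⟩
  obtain ⟨g, hg, hgs⟩ := Set.mem_iUnion₂.1 (ht hs)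
  obtain ⟨a, ha, b, hb, hab⟩ := Set.mem_div.1 hgs
  have h1 : s = g⁻¹ * (a * b⁻¹) := by
    rw [← div_eq_mul_inv, hab]
    group
  have h2 : L.toFun g ≤ ∑ g ∈ t, L.toFun g :=
    Finset.single_le_sum (f := L.toFun) (fun i _ => L.nonneg' i) hg
  have h3 := L.map_mul_le' g⁻¹ (a * b⁻¹)
  have h4 := L.map_mul_le' a b⁻¹
  rw [L.symm'] at h3 h4
  have h5 : L.toFun a ≤ n := ha.2
  have h6 : L.toFun b ≤ n := hb.2
  rw [h1]
  linarith

/-- The weighted measure is finite on compact sets. -/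
theorem weightedMeasure_isFiniteMeasureOnCompacts (μ : Measure G) [μ.IsHaarMeasure] [μ.Regular]
    (L : LengthFunction G) (r : ℝ≥0∞) (d : ℝ) :
    IsFiniteMeasureOnCompacts (weightedMeasure μ L r d) := by
  refine ⟨fun K hK => ?_⟩
  obtain ⟨C, hC⟩ := L.exists_bound_of_isCompact μ hK
  rw [weightedMeasure, withDensity_apply _ hK.measurableSet]
  refine setLIntegral_lt_top_of_le_nnreal hK.measure_lt_top.ne
    ⟨Real.toNNReal ((1 + C) ^ |r.toReal * d|), fun s hs => ?_⟩
  refine ENNReal.ofReal_le_ofReal ?_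
  have h0 := L.nonneg' s
  have h1 := hC s hs
  calc polyWeight L (r.toReal * d) s ≤ (1 + L.toFun s) ^ |r.toReal * d| :=
        Real.rpow_le_rpow_of_exponent_le (by linarith) (le_abs_self _)
    _ ≤ (1 + C) ^ |r.toReal * d| :=
        Real.rpow_le_rpow (by linarith) (by linarith) (abs_nonneg _)

/-- Continuous functions with compact support lie in `L^r(G, ω_d)`. -/
theorem memLp_weightedMeasure (μ : Measure G) [μ.IsHaarMeasure] [μ.Regular]
    (L : LengthFunction G) (r : ℝ≥0∞) (d : ℝ) (f : C_c(G, ℂ)) :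
    MemLp f r (weightedMeasure μ L r d) := by
  have := weightedMeasure_isFiniteMeasureOnCompacts μ L r d
  exact f.continuous.memLp_of_hasCompactSupport f.hasCompactSupport

/-- The canonical inclusion `C_c(G) ⊆ L^r(G, ω_d)`. -/
noncomputable def ccToWeightedLp (μ : Measure G) [μ.IsHaarMeasure] [μ.Regular]
    (L : LengthFunction G) (r : ℝ≥0∞) (d : ℝ) (f : C_c(G, ℂ)) : WeightedLp μ L r d :=
  (memLp_weightedMeasure μ L r d f).toLp f

end LocallyCompact

/-- `IsConvOp μ f T` says that `T` is the operator `λ_p(f) : g ↦ f * g` on `L^p(G)`. -/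
def IsConvOp {G : Type*} [Group G] [MeasurableSpace G] (μ : Measure G) {p : ℝ≥0∞}
    [Fact (1 ≤ p)] (f : G → ℂ) (T : Lp ℂ p μ →L[ℂ] Lp ℂ p μ) : Prop :=
  ∀ g : Lp ℂ p μ, T g =ᵐ[μ] groupConv μ f g

/-- The reduced group C*-algebra: the norm closure of `λ_2(L^1(G))` in `B(L^2(G))`.
(The set `λ_2(L^1(G))` is already an algebra; `adjoin` only bundles it as one.) -/
noncomputable def reducedGroupAlgebra {G : Type*} [Group G] [MeasurableSpace G]
    (μ : Measure G) : NonUnitalSubalgebra ℂ (Lp ℂ 2 μ →L[ℂ] Lp ℂ 2 μ) :=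
  (NonUnitalAlgebra.adjoin ℂ
    {T | ∃ f : G → ℂ, Integrable f μ ∧ IsConvOp μ f T}).topologicalClosure

/-- The symmetrized algebra of pseudofunctions `PF_p^*(G)`, where `q` is the conjugate exponent
of `p`: the completion of `L^1(G)` in the norm `f ↦ max {‖λ_p(f)‖, ‖λ_q(f)‖}`, realized as the
norm closure of `{(λ_p(f), λ_q(f)) : f ∈ L^1(G)}` in `B(L^p(G)) × B(L^q(G))` with the maximum norm.
(This set of pairs is already an algebra; `adjoin` only bundles it as one.) -/
noncomputable def symPseudofunctions {G : Type*} [Group G] [MeasurableSpace G]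
    (μ : Measure G) (p q : ℝ≥0∞) [Fact (1 ≤ p)] [Fact (1 ≤ q)] :
    NonUnitalSubalgebra ℂ ((Lp ℂ p μ →L[ℂ] Lp ℂ p μ) × (Lp ℂ q μ →L[ℂ] Lp ℂ q μ)) :=
  (NonUnitalAlgebra.adjoin ℂ
    {T | ∃ f : G → ℂ, Integrable f μ ∧ IsConvOp μ f T.1 ∧ IsConvOp μ f T.2}).topologicalClosure

section RapidDecay

variable {G : Type*} [Group G] [TopologicalSpace G] [IsTopologicalGroup G]
  [LocallyCompactSpace G] [T2Space G] [MeasurableSpace G] [BorelSpace G]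

/-- `L^2(G, ω_d) ⊆ C*_r(G)`: the canonical inclusion of `C_c(G)` in `C*_r(G)` extends to a bounded
linear map on `L^2(G, ω_d)`. -/
def L2IncludedInReduced (μ : Measure G) [μ.IsHaarMeasure] [μ.Regular] (L : LengthFunction G)
    (d : ℝ) : Prop :=
  ∃ J : WeightedLp μ L 2 d →L[ℂ] reducedGroupAlgebra μ,
    ∀ f : C_c(G, ℂ), IsConvOp μ f (J (ccToWeightedLp μ L 2 d f)).1

/-- `(G, L)` has rapid decay. -/
def HasRapidDecay (μ : Measure G) [μ.IsHaarMeasure] [μ.Regular] (L : LengthFunction G) : Prop :=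
  ∃ d : ℝ, 0 < d ∧ L2IncludedInReduced μ L d

/-- The rapid-decay degree `rd(G)` with respect to `L`. -/
noncomputable def rapidDecayDegree (μ : Measure G) [μ.IsHaarMeasure] [μ.Regular]
    (L : LengthFunction G) : ℝ :=
  sInf {d : ℝ | 0 ≤ d ∧ L2IncludedInReduced μ L d}

end RapidDecay

/-! The theorem interpolates between two bounds for convolution by `f`: the trivial one, `L¹(G)`
acting on `L¹(G)` and on `L^∞(G)`, and rapid decay, `L²(G, ω_d)` acting on `L²(G)`. With `θ = 2/p`
one has `1/q = (1 - θ) + θ/2`, and the interpolated weight is `ω_{dθ} = ω_{2d/p}`. This gives `‖f *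
g‖_r ≤ C^θ ‖f‖_{L^q(G, ω_{dθ})} ‖g‖_r` for `r = q` (against the `L¹` endpoint) and for `r = p`
(against the `L^∞` endpoint).

No complex interpolation is needed, because `|f * g| ≤ |f| * |g|` and everything can be taken
nonnegative. One writes `|f| = F₀^{1-θ} F₁^θ` with `F₀ = |f|^q ω^{q dθ}` in `L¹` and `F₁ = |f|^{q/2}
ω^{q dθ/2 - d}` in `L²(G, ω_d)` (`enorm_eq_endpoints`), factors `|g|` likewise, and applies Hölder
in the integration variable. For `r = q` a second Hölder inequality, in the outer variable,
finishes; for `r = p` raising to the power `p` suffices (`eLpNorm_groupConv_le_of_le_two`,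
`eLpNorm_groupConv_le_of_two_le`).

Rapid decay also forces `G` to be unimodular: translating `f` on the right and `g` on the left by
inverse elements bounds the modular function by a polynomial in the length, which a homomorphism to
the positive reals can only satisfy if it is trivial. Hence reflection `s ↦ s⁻¹` preserves all `L^r`
norms and exchanges the two factors of a convolution, so each bound is available on either side.

The algebra property follows from `ω(s) ≤ 2^e (ω(t) + ω(t⁻¹s))`, which gives `ω|f * g| ≤ 2^e ((ω|f|)
* |g| + |f| * (ω|g|))`; both terms are bounded by the action on `L^q`. Density of `C_c(G)` extends
the product and the operators. For injectivity, if `x` is sent to `0` then `x * g = 0` for every `g`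
in `C_c(G)`; evaluating at `1` shows that `x` annihilates `C_c(G)`. -/

set_option linter.unusedSectionVars false

/-! ### Null sets under inversion, before unimodularity is known -/

section HaarInv

variable {G : Type*} [Group G] [TopologicalSpace G] [IsTopologicalGroup G]
  [LocallyCompactSpace G] [T2Space G] [MeasurableSpace G] [BorelSpace G]

/-- Comparing the left-invariant `μ` with the right-invariant `μ.inv` gives, on continuous compactly
supported functions, `dμ = c D⁻¹ dμ.inv` with `D` continuous and positive. On `K` the density is
bounded below, so a bump function squeezed between `K` and an open set of small `μ`-measure bounds
`μ.inv K`. -/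
theorem measure_inv_isCompact_eq_zero (μ : Measure G) [μ.IsHaarMeasure] [μ.Regular] {K : Set G}
    (hK : IsCompact K) (h : μ K = 0) : μ.inv K = 0 := by
  obtain ⟨⟨g, g_cont⟩, g_comp, g_nonneg, g_one⟩ :
    ∃ f : C(G, ℝ), HasCompactSupport f ∧ 0 ≤ f ∧ f 1 ≠ 0 := exists_continuous_nonneg_pos 1
  have hI : 0 < ∫ x, g x ∂μ :=
    g_cont.integral_pos_of_hasCompactSupport_nonneg_nonzero g_comp g_nonneg g_one
  set D : G → ℝ := fun y => ∫ z, g (z⁻¹ * y) ∂μ.inv with hD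
  have hDc : Continuous D := continuous_integral_apply_inv_mul g_cont g_comp
  have hDpos : ∀ x, 0 < D x := by
    intro x
    refine Continuous.integral_pos_of_hasCompactSupport_nonneg_nonzero (x := x) (by fun_prop)
      ?_ (fun y => g_nonneg (y⁻¹ * x)) (by simpa using g_one)
    exact g_comp.comp_homeomorph ((Homeomorph.inv G).trans (Homeomorph.mulRight x))
  obtain ⟨M, hM⟩ := hK.bddAbove_image hDc.continuousOn
  -- The maximum with `1` keeps the bound positive even when `K` is empty and `M` is arbitrary.
  have hMD : ∀ x ∈ K, D x ≤ max M 1 := fun x hx => (hM ⟨x, hx, rfl⟩).trans (le_max_left _ _)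
  have hM0 : 0 < max M 1 := lt_max_of_lt_right one_pos
  have key : ∀ ε : ℝ, 0 < ε → (max M 1)⁻¹ * μ.inv.real K * ∫ x, g x ∂μ ≤ ε := by
    intro ε hε
    obtain ⟨U, hKU, hU, hUε⟩ := K.exists_isOpen_lt_of_lt (μ := μ) (ENNReal.ofReal ε)
      (by rw [h]; exact ENNReal.ofReal_pos.2 hε)
    obtain ⟨f, hf1, hf0, hfc, hf01⟩ := exists_continuous_one_zero_of_isCompact hK
      hU.isClosed_compl (Set.disjoint_compl_right_iff_subset.2 hKU)
    have hUfin : μ U ≠ ∞ := (hUε.trans ENNReal.ofReal_lt_top).ne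
    have h1 : ∫ x, f x ∂μ ≤ ε := by
      calc ∫ x, f x ∂μ ≤ ∫ x, U.indicator (fun _ => (1 : ℝ)) x ∂μ := by
            refine integral_mono (f.continuous.integrable_of_hasCompactSupport hfc)
              ((integrable_indicator_iff hU.measurableSet).2 (integrableOn_const hUfin))
              fun x => ?_
            by_cases hx : x ∈ U
            · simpa [hx] using (hf01 x).2
            · simpa [hx] using (hf0 hx).le
        _ = μ.real U := by simp [integral_indicator hU.measurableSet]
        _ ≤ ε := by
            rw [Measure.real, ← ENNReal.toReal_ofReal hε.le]
            exact ENNReal.toReal_mono ENNReal.ofReal_ne_top hUε.le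
    rw [Measure.integral_isMulLeftInvariant_isMulRightInvariant_combo (μ := μ) (ν := μ.inv) f.continuous
      hfc g_cont g_comp g_nonneg g_one] at h1
    refine le_trans (mul_le_mul_of_nonneg_right ?_ hI.le) h1
    calc (max M 1)⁻¹ * μ.inv.real K = ∫ x, K.indicator (fun _ => (max M 1)⁻¹) x ∂μ.inv := by
          simp [integral_indicator hK.measurableSet, mul_comm]
      _ ≤ ∫ x, f x * (D x)⁻¹ ∂μ.inv := by
          refine integral_mono ((integrable_indicator_iff hK.measurableSet).2
              (integrableOn_const hK.measure_lt_top.ne))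
            (Continuous.integrable_of_hasCompactSupport
              (f.continuous.mul (hDc.inv₀ fun x => (hDpos x).ne')) hfc.mul_right) fun x => ?_
          by_cases hx : x ∈ K
          · have : f x = 1 := hf1 hx
            simp only [hx, Set.indicator_of_mem, this, one_mul]
            exact inv_anti₀ (hDpos x) (hMD x hx)
          · simp only [hx, not_false_eq_true, Set.indicator_of_notMem]
            exact mul_nonneg (hf01 x).1 (inv_nonneg.2 (hDpos x).le)
  have h0 : (max M 1)⁻¹ * μ.inv.real K * ∫ x, g x ∂μ ≤ 0 :=
    le_of_forall_pos_le_add fun ε hε => by simpa using key ε hε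
  have h2 : μ.inv.real K = 0 := by
    refine le_antisymm ?_ measureReal_nonneg
    by_contra! hlt
    exact absurd h0 (not_le.2 (mul_pos (mul_pos (inv_pos.2 hM0) hlt) hI))
  exact (measureReal_eq_zero_iff hK.measure_lt_top.ne).1 h2

/-- Inversion preserves null sets locally. -/
theorem measure_inter_inv_eq_zero (μ : Measure G) [μ.IsHaarMeasure] [μ.Regular] {N K : Set G}
    (hK : IsCompact K) (hN : μ N = 0) : μ (K ∩ N⁻¹) = 0 := by
  set A := K⁻¹ ∩ toMeasurable μ N with hA
  have hAm : MeasurableSet A := hK.inv.measurableSet.inter (measurableSet_toMeasurable _ _)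
  have h1 : μ.inv A = 0 := by
    by_contra hne
    have hfin : μ.inv A ≠ ∞ :=
      ((measure_mono Set.inter_subset_left).trans_lt hK.inv.measure_lt_top).ne
    -- `A` lies in a compact set, so inner regularity reduces the claim to compact subsets of `A`.
    obtain ⟨C, hCA, hC, hpos⟩ := hAm.exists_lt_isCompact_of_ne_top hfin (pos_iff_ne_zero.2 hne)
    refine hpos.ne' (measure_inv_isCompact_eq_zero μ hC (measure_mono_null hCA ?_))
    exact measure_mono_null Set.inter_subset_right (by rwa [measure_toMeasurable])
  rw [Measure.inv_apply] at h1
  refine measure_mono_null ?_ h1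
  rintro x ⟨hx, hxN⟩
  exact ⟨by simpa using hx, subset_toMeasurable _ _ hxN⟩

/-- The convolution with a compactly supported left factor depends only on the class of the right
factor. -/
theorem groupConv_congr_right (μ : Measure G) [μ.IsHaarMeasure] [μ.Regular] (f : C_c(G, ℂ))
    {g g' : G → ℂ} (h : g =ᵐ[μ] g') : groupConv μ f g = groupConv μ f g' := by
  funext s
  refine integral_congr_ae ?_
  have h0 : μ {x | g x ≠ g' x} = 0 := h
  have h1 : μ ((fun t => s⁻¹ * t) ⁻¹' (((fun t => s⁻¹ * t) '' tsupport f) ∩ {x | g x ≠ g' x}⁻¹)) = 0 := by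
    rw [measure_preimage_mul]
    exact measure_inter_inv_eq_zero μ (f.hasCompactSupport.isCompact.image (by fun_prop)) h0
  refine measure_mono_null (fun t ht => ?_) h1
  have ht' : f t * g (t⁻¹ * s) ≠ f t * g' (t⁻¹ * s) := ht
  refine ⟨⟨t, subset_tsupport _ fun h => ht' (by simp [h]), rfl⟩, ?_⟩
  simp only [Set.mem_inv, mul_inv_rev, inv_inv]
  intro hh
  exact ht' (by rw [hh])

end HaarInv

/-! ### Polynomial weights and weighted measures -/

section Weight

variable {G : Type*} [Group G] [MeasurableSpace G] (L : LengthFunction G)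

theorem one_le_one_add_length (s : G) : 1 ≤ 1 + L.toFun s := by linarith [L.nonneg' s]

theorem one_add_length_pos (s : G) : 0 < 1 + L.toFun s := by linarith [L.nonneg' s]

theorem polyWeight_pos (d : ℝ) (s : G) : 0 < polyWeight L d s :=
  Real.rpow_pos_of_pos (one_add_length_pos L s) d

theorem measurable_polyWeight (d : ℝ) : Measurable (polyWeight L d) :=
  (L.measurable'.const_add 1).pow_const d

/-- From `1 + a + b ≤ (1 + a)(1 + b)`; it controls how the weighted norm changes under right
translation. -/
theorem polyWeight_le_mul {d : ℝ} (hd : 0 ≤ d) (s t : G) :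
    polyWeight L d s ≤ polyWeight L d (s * t) * polyWeight L d t := by
  have h := L.map_mul_le' (s * t) t⁻¹
  rw [mul_inv_cancel_right, L.symm'] at h
  have h1 := L.nonneg' (s * t)
  have h2 := L.nonneg' t
  rw [polyWeight, polyWeight, polyWeight, ← Real.mul_rpow (by linarith) (by linarith)]
  exact Real.rpow_le_rpow (one_add_length_pos L s).le (by nlinarith) hd

theorem polyWeight_inv (d : ℝ) (s : G) : polyWeight L d s⁻¹ = polyWeight L d s := by
  rw [polyWeight, polyWeight, L.symm']

theorem polyWeight_mono {d e : ℝ} (h : d ≤ e) (s : G) : polyWeight L d s ≤ polyWeight L e s :=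
  Real.rpow_le_rpow_of_exponent_le (one_le_one_add_length L s) h

theorem polyWeight_zero : polyWeight L 0 = fun _ => 1 := by
  funext s
  simp [polyWeight]

theorem weightedMeasure_zero (μ : Measure G) (r : ℝ≥0∞) : weightedMeasure μ L r 0 = μ := by
  simp [weightedMeasure, polyWeight_zero]

theorem lintegral_weightedMeasure (μ : Measure G) (r : ℝ≥0∞) (d : ℝ) (h : G → ℝ≥0∞) :
    ∫⁻ s, h s ∂weightedMeasure μ L r d =
      ∫⁻ s, ENNReal.ofReal (polyWeight L (r.toReal * d) s) * h s ∂μ := by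
  rw [weightedMeasure, lintegral_withDensity_eq_lintegral_mul_non_measurable _
    (measurable_polyWeight L _).ennreal_ofReal (by simp)]
  rfl

theorem weightedMeasure_absolutelyContinuous (μ : Measure G) (r : ℝ≥0∞) (d : ℝ) :
    weightedMeasure μ L r d ≪ μ :=
  withDensity_absolutelyContinuous _ _

theorem absolutelyContinuous_weightedMeasure (μ : Measure G) (r : ℝ≥0∞) (d : ℝ) :
    μ ≪ weightedMeasure μ L r d :=
  withDensity_absolutelyContinuous' (measurable_polyWeight L _).ennreal_ofReal.aemeasurable
    (by simp [polyWeight_pos])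

theorem eLpNorm_rpow_eq_lintegral {α : Type*} [MeasurableSpace α] (ν : Measure α) {r : ℝ≥0∞}
    (h0 : r ≠ 0) (ht : r ≠ ∞) (f : α → ℂ) :
    eLpNorm f r ν ^ r.toReal = ∫⁻ s, ‖f s‖ₑ ^ r.toReal ∂ν := by
  rw [eLpNorm_eq_lintegral_rpow_enorm_toReal h0 ht, ← ENNReal.rpow_mul, one_div,
    inv_mul_cancel₀ (ENNReal.toReal_pos h0 ht).ne', ENNReal.rpow_one]

theorem eLpNorm_weightedMeasure_rpow (μ : Measure G) {r : ℝ≥0∞} (h0 : r ≠ 0) (ht : r ≠ ∞)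
    (d : ℝ) (f : G → ℂ) :
    eLpNorm f r (weightedMeasure μ L r d) ^ r.toReal =
      ∫⁻ s, ENNReal.ofReal (polyWeight L (r.toReal * d) s) * ‖f s‖ₑ ^ r.toReal ∂μ := by
  rw [eLpNorm_rpow_eq_lintegral _ h0 ht, lintegral_weightedMeasure]

theorem weightedMeasure_mono (μ : Measure G) (r : ℝ≥0∞) {d e : ℝ} (h : d ≤ e) :
    weightedMeasure μ L r d ≤ weightedMeasure μ L r e :=
  withDensity_mono (ae_of_all _ fun s => ENNReal.ofReal_le_ofReal
    (polyWeight_mono L (mul_le_mul_of_nonneg_left h ENNReal.toReal_nonneg) s))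

theorem length_pow_le (t : G) (n : ℕ) : L.toFun (t ^ n) ≤ n * L.toFun t := by
  induction n with
  | zero => simp [L.map_one']
  | succ n ih =>
    rw [pow_succ]
    push_cast
    linarith [L.map_mul_le' (t ^ n) t]

end Weight

/-! ### Continuity of convolutions and the inequality extracted from rapid decay -/

section Continuity

variable {G : Type*} [Group G] [TopologicalSpace G] [IsTopologicalGroup G]
  [LocallyCompactSpace G] [T2Space G] [MeasurableSpace G] [BorelSpace G]

open scoped Pointwise in
-- For `x` in a compact neighbourhood `t`, all the functions `y ↦ g (y⁻¹ x)` are supported in the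
-- single compact set `t * (tsupport g)⁻¹`, so only local integrability of `u` matters.
theorem continuous_groupConv (μ : Measure G) [μ.IsHaarMeasure] {u : G → ℂ}
    (hu : LocallyIntegrable u μ) (g : C_c(G, ℂ)) : Continuous (groupConv μ u g) := by
  apply continuous_iff_continuousAt.2 (fun x₀ ↦ ?_)
  obtain ⟨t, t_comp, ht⟩ : ∃ t, IsCompact t ∧ t ∈ nhds x₀ := exists_compact_mem_nhds x₀
  have k_comp : IsCompact (t * (tsupport g)⁻¹) := t_comp.mul g.hasCompactSupport.isCompact.inv
  have A : ContinuousOn (groupConv μ u g) t := by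
    refine continuousOn_integral_bilinear_of_locally_integrable_of_compact_support
      (ContinuousLinearMap.mul ℂ ℂ) (f := fun x y => g (y⁻¹ * x)) k_comp ?_ ?_
      (hu.integrableOn_isCompact k_comp)
    · exact (g.continuous.comp (continuous_snd.inv.mul continuous_fst)).continuousOn
    · intro p x hp hx
      contrapose! hx
      refine ⟨p, hp, p⁻¹ * x, ?_, by simp⟩
      simpa only [Set.mem_inv, mul_inv_rev, inv_inv] using subset_tsupport _ hx
  exact A.continuousAt ht

theorem locallyIntegrable_cc (μ : Measure G) [IsFiniteMeasureOnCompacts μ] (f : C_c(G, ℂ)) :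
    LocallyIntegrable f μ :=
  (f.continuous.integrable_of_hasCompactSupport f.hasCompactSupport).locallyIntegrable

/-- Right translation of a compactly supported function. -/
noncomputable def ccMulRight (t : G) (f : C_c(G, ℂ)) : C_c(G, ℂ) :=
  ⟨⟨fun s => f (s * t), f.continuous.comp (continuous_mul_const t)⟩,
    f.hasCompactSupport.comp_homeomorph (Homeomorph.mulRight t)⟩

/-- Left translation of a compactly supported function. -/
noncomputable def ccMulLeft (t : G) (f : C_c(G, ℂ)) : C_c(G, ℂ) :=
  ⟨⟨fun s => f (t * s), f.continuous.comp (continuous_const_mul t)⟩,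
    f.hasCompactSupport.comp_homeomorph (Homeomorph.mulLeft t)⟩

/-- Reflection of a compactly supported function. -/
noncomputable def ccInv (f : C_c(G, ℂ)) : C_c(G, ℂ) :=
  ⟨⟨fun s => f s⁻¹, f.continuous.comp continuous_inv⟩,
    f.hasCompactSupport.comp_homeomorph (Homeomorph.inv G)⟩

@[simp] theorem ccMulRight_apply (t : G) (f : C_c(G, ℂ)) (s : G) :
    ccMulRight t f s = f (s * t) := rfl

@[simp] theorem ccMulLeft_apply (t : G) (f : C_c(G, ℂ)) (s : G) :
    ccMulLeft t f s = f (t * s) := rfl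

@[simp] theorem ccInv_apply (f : C_c(G, ℂ)) (s : G) : ccInv f s = f s⁻¹ := rfl

/-- The bound on convolution operators given by an inclusion `L²(G, ω_d) ⊆ C*_r(G)`. -/
theorem L2IncludedInReduced.exists_bound {μ : Measure G} [μ.IsHaarMeasure] [μ.Regular]
    {L : LengthFunction G} {d : ℝ} (h : L2IncludedInReduced μ L d) :
    ∃ C : NNReal, ∀ f g : C_c(G, ℂ), eLpNorm (groupConv μ f g) 2 μ ≤
      C * eLpNorm f 2 (weightedMeasure μ L 2 d) * eLpNorm g 2 μ := by
  obtain ⟨J, hJ⟩ := h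
  -- Only boundedness of the inclusion into `B(L²(G))` is used, so the values are taken there.
  let T : WeightedLp μ L 2 d →L[ℂ] Lp ℂ 2 μ →L[ℂ] Lp ℂ 2 μ :=
    { toFun := fun x => (J x).1
      map_add' := fun x y => by simp
      map_smul' := fun c x => congrArg Subtype.val (J.map_smul c x)
      cont := continuous_subtype_val.comp J.continuous }
  refine ⟨‖T‖₊, fun f g => ?_⟩
  have hg : MemLp g 2 μ := g.continuous.memLp_of_hasCompactSupport g.hasCompactSupport
  have h1 := hJ f (hg.toLp g)
  rw [groupConv_congr_right μ f hg.coeFn_toLp] at h1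
  rw [← eLpNorm_congr_ae h1, ← Lp.enorm_def]
  refine (ContinuousLinearMap.le_opENorm _ _).trans ?_
  rw [Lp.enorm_toLp]
  gcongr
  have h2 := T.le_opENorm (ccToWeightedLp μ L 2 d f)
  rw [ccToWeightedLp, Lp.enorm_toLp] at h2
  exact h2

end Continuity

/-! ### Rapid decay implies unimodularity -/

section Unimodular

variable {G : Type*} [Group G] [TopologicalSpace G] [IsTopologicalGroup G]
  [LocallyCompactSpace G] [T2Space G] [MeasurableSpace G] [BorelSpace G]

/-- Exponential growth beats polynomial growth; for `n ≥ 1` the base `1 + n a` is at most `(1 + a)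
n`. -/
theorem le_one_of_forall_pow_le {c K a : ℝ} (ha : 0 ≤ a) {e : ℝ} (hK : 0 ≤ K)
    (h : ∀ n : ℕ, c ^ n ≤ K * (1 + n * a) ^ e) : c ≤ 1 := by
  by_contra! hc
  set k := ⌈e⌉₊
  have h1 := (tendsto_pow_const_div_const_pow_of_one_lt k hc).const_mul (K * (1 + a) ^ k)
  rw [mul_zero] at h1
  obtain ⟨n, hn, hn1⟩ := ((h1.eventually (gt_mem_nhds one_pos)).and
    (Filter.eventually_ge_atTop 1)).exists
  have hn1' : (1 : ℝ) ≤ n := by exact_mod_cast hn1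
  have hcn : 0 < c ^ n := by positivity
  have h2 : (1 + n * a) ^ e ≤ ((1 + a) * n) ^ k := by
    calc (1 + n * a) ^ e ≤ (1 + n * a) ^ (k : ℝ) :=
          Real.rpow_le_rpow_of_exponent_le (by nlinarith) (Nat.le_ceil e)
      _ = (1 + n * a) ^ k := Real.rpow_natCast _ _
      _ ≤ _ := pow_le_pow_left₀ (by positivity) (by nlinarith) _
  have h3 : c ^ n ≤ K * (1 + a) ^ k * n ^ k := by
    rw [mul_assoc, ← mul_pow]
    exact (h n).trans (mul_le_mul_of_nonneg_left h2 hK)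
  rw [← mul_div_assoc, div_lt_one hcn] at hn
  linarith

open Measure in
theorem map_mul_right_eq_smul (μ : Measure G) [μ.IsHaarMeasure] [μ.Regular] (t : G) :
    Measure.map (· * t) μ = modularCharacterFun t • μ := by
  have : Regular (Measure.map (· * t) μ) := Regular.map (Homeomorph.mulRight t)
  rw [modularCharacterFun_eq_haarScalarFactor μ]
  exact isMulLeftInvariant_eq_smul_of_regular _ μ

open Measure in
theorem lintegral_mul_right_eq_modular (μ : Measure G) [μ.IsHaarMeasure] [μ.Regular] (t : G)
    (h : G → ℝ≥0∞) : ∫⁻ s, h (s * t) ∂μ = modularCharacterFun t * ∫⁻ s, h s ∂μ := by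
  have := lintegral_map_equiv (μ := μ) h (MeasurableEquiv.mulRight t)
  rw [MeasurableEquiv.coe_mulRight, map_mul_right_eq_smul] at this
  rw [← this, lintegral_smul_measure]
  rfl

open Measure in
-- In the variable `v = u t` the two translations cancel, and only the modular factor of the
-- substitution remains.
theorem groupConv_ccMulRight (μ : Measure G) [μ.IsHaarMeasure] [μ.Regular] (t : G)
    (f g : C_c(G, ℂ)) : groupConv μ (ccMulRight t f) (ccMulLeft t⁻¹ g) =
      (modularCharacterFun t : ℝ) • groupConv μ f g := by
  funext s
  have := (MeasurableEquiv.mulRight t).measurableEmbedding.integral_map (μ := μ)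
    (fun v => f v * g (v⁻¹ * s))
  rw [MeasurableEquiv.coe_mulRight, map_mul_right_eq_smul, integral_smul_nnreal_measure] at this
  rw [Pi.smul_apply, groupConv, groupConv]
  refine Eq.trans ?_ this.symm
  simp [mul_assoc]

open Measure in
/-- Rapid decay forces the modular function to be at most one. -/
theorem modularCharacterFun_le_one {μ : Measure G} [μ.IsHaarMeasure] [μ.Regular]
    {L : LengthFunction G} {d : ℝ} (hd : 0 ≤ d) {C : NNReal}
    (hC : ∀ f g : C_c(G, ℂ), eLpNorm (groupConv μ f g) 2 μ ≤
      C * eLpNorm f 2 (weightedMeasure μ L 2 d) * eLpNorm g 2 μ) (t : G) :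
    modularCharacterFun t ≤ 1 := by
  obtain ⟨⟨φ, φ_cont⟩, φ_comp, φ_nonneg, φ_one⟩ :
    ∃ f : C(G, ℝ), HasCompactSupport f ∧ 0 ≤ f ∧ f 1 ≠ 0 := exists_continuous_nonneg_pos 1
  let f : C_c(G, ℂ) := ⟨⟨fun s => φ s, by fun_prop⟩, φ_comp.comp_left Complex.ofReal_zero⟩
  let g := ccInv f
  have hf2 : MemLp f 2 (weightedMeasure μ L 2 d) := memLp_weightedMeasure μ L 2 d f
  have hg2 : MemLp g 2 μ := g.continuous.memLp_of_hasCompactSupport g.hasCompactSupport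
  -- With `g` the reflection of `f`, the value of the convolution at `1` is `∫ φ²`, which is
  -- positive.
  have hX0 : eLpNorm (groupConv μ f g) 2 μ ≠ 0 := by
    have hcont := continuous_groupConv μ (locallyIntegrable_cc μ f) g
    intro h0
    rw [eLpNorm_eq_zero_iff hcont.aestronglyMeasurable (by simp),
      hcont.ae_eq_iff_eq μ continuous_zero] at h0
    have h1 := congrFun h0 1
    have hf : ∀ s, f s = (φ s : ℂ) := fun _ => rfl
    simp only [groupConv, g, ccInv_apply, hf, mul_one, inv_inv, ← Complex.ofReal_mul,
      Pi.zero_apply] at h1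
    have h1 := integral_ofReal.symm.trans h1
    rw [RCLike.ofReal_eq_zero] at h1
    refine (Continuous.integral_pos_of_hasCompactSupport_nonneg_nonzero (x := (1 : G)) (μ := μ)
      (f := fun s => φ s * φ s) (by fun_prop) φ_comp.mul_right
      (fun s => mul_self_nonneg _) (mul_self_ne_zero.2 φ_one)).ne' h1
  have hX1 : eLpNorm (groupConv μ f g) 2 μ ≠ ∞ :=
    ((hC f g).trans_lt (ENNReal.mul_lt_top (ENNReal.mul_lt_top ENNReal.coe_lt_top hf2.2)
      hg2.2)).ne
  -- The inequality `hC` is tested on the translated pair: the left side, squared, gains the square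
  -- of the modular function, while the right side gains only its first power and a weight.
  have key : ∀ u : G, (modularCharacterFun u : ℝ≥0∞) * eLpNorm (groupConv μ f g) 2 μ ^ (2 : ℝ) ≤
      ENNReal.ofReal (polyWeight L (2 * d) u) * ((C : ℝ≥0∞) ^ (2 : ℝ) *
        eLpNorm f 2 (weightedMeasure μ L 2 d) ^ (2 : ℝ) * eLpNorm g 2 μ ^ (2 : ℝ)) := by
    intro u
    have h1 := ENNReal.rpow_le_rpow (hC (ccMulRight u f) (ccMulLeft u⁻¹ g)) (zero_le_two (α := ℝ))
    have h2 : eLpNorm (ccMulLeft u⁻¹ g) 2 μ = eLpNorm g 2 μ :=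
      eLpNorm_comp_measurePreserving (g := g) g.continuous.aestronglyMeasurable
        (measurePreserving_mul_left μ u⁻¹)
    have h3 : eLpNorm (ccMulRight u f) 2 (weightedMeasure μ L 2 d) ^ (2 : ℝ) ≤
        modularCharacterFun u * (ENNReal.ofReal (polyWeight L (2 * d) u) *
          eLpNorm f 2 (weightedMeasure μ L 2 d) ^ (2 : ℝ)) := by
      have := eLpNorm_weightedMeasure_rpow L μ (r := 2) (by simp) (by simp) d f
      have h' := eLpNorm_weightedMeasure_rpow L μ (r := 2) (by simp) (by simp) d (ccMulRight u f)
      simp only [ENNReal.toReal_ofNat] at this h'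
      rw [this, h', ← lintegral_const_mul' _ _ ENNReal.ofReal_ne_top,
        ← lintegral_mul_right_eq_modular]
      refine lintegral_mono fun s => ?_
      rw [← mul_assoc, ← ENNReal.ofReal_mul (polyWeight_pos L _ _).le]
      rw [ccMulRight_apply]
      gcongr
      exact (polyWeight_le_mul L (by linarith) s u).trans_eq (mul_comm _ _)
    rw [groupConv_ccMulRight, eLpNorm_const_smul, h2, ENNReal.mul_rpow_of_nonneg _ _ zero_le_two,
      ENNReal.mul_rpow_of_nonneg _ _ zero_le_two, ENNReal.mul_rpow_of_nonneg _ _ zero_le_two] at h1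
    have hc0 : (modularCharacterFun u : ℝ≥0∞) ≠ 0 := by
      simpa using (modularCharacterFun_pos u).ne'
    have hce : ‖(modularCharacterFun u : ℝ)‖ₑ = modularCharacterFun u := by
      simp [enorm_eq_nnnorm]
    rw [hce] at h1
    refine (ENNReal.mul_le_mul_iff_right hc0 ENNReal.coe_ne_top).1 ?_
    calc _ = (modularCharacterFun u : ℝ≥0∞) ^ (2 : ℝ) *
          eLpNorm (groupConv μ f g) 2 μ ^ (2 : ℝ) := by
          simp only [ENNReal.rpow_two]
          ring
      _ ≤ _ := h1
      _ ≤ _ := by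
          grw [h3]
          apply le_of_eq
          ring
  set X := eLpNorm (groupConv μ f g) 2 μ ^ (2 : ℝ) with hX
  set B := (C : ℝ≥0∞) ^ (2 : ℝ) *
        eLpNorm f 2 (weightedMeasure μ L 2 d) ^ (2 : ℝ) * eLpNorm g 2 μ ^ (2 : ℝ) with hB
  have hXpos : 0 < X.toReal := ENNReal.toReal_pos
    (by simp [hX, hX0]) (ENNReal.rpow_ne_top_of_nonneg zero_le_two hX1)
  have hBt : B ≠ ∞ := ENNReal.mul_ne_top (ENNReal.mul_ne_top
    (ENNReal.rpow_ne_top_of_nonneg zero_le_two ENNReal.coe_ne_top)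
    (ENNReal.rpow_ne_top_of_nonneg zero_le_two hf2.2.ne))
    (ENNReal.rpow_ne_top_of_nonneg zero_le_two hg2.2.ne)
  have key' : ∀ u : G, (modularCharacterFun u : ℝ) ≤
      B.toReal / X.toReal * (1 + L.toFun u) ^ (2 * d) := by
    intro u
    have h1 := ENNReal.toReal_mono (ENNReal.mul_ne_top ENNReal.ofReal_ne_top hBt) (key u)
    rw [ENNReal.toReal_mul, ENNReal.toReal_mul, ENNReal.toReal_ofReal (polyWeight_pos L _ _).le,
      ENNReal.coe_toReal] at h1
    rw [div_mul_eq_mul_div, le_div_iff₀ hXpos, mul_comm B.toReal]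
    exact h1
  -- Applied to powers of `t`, where the modular function is multiplicative and the length grows at
  -- most linearly.
  have := le_one_of_forall_pow_le (c := modularCharacterFun t) (L.nonneg' t) (e := 2 * d)
    (div_nonneg ENNReal.toReal_nonneg ENNReal.toReal_nonneg) fun n => by
      have h1 := key' (t ^ n)
      have h2 : modularCharacterFun (t ^ n) = modularCharacterFun t ^ n :=
        map_pow (modularCharacter (G := G)) t n
      rw [h2, NNReal.coe_pow] at h1
      refine h1.trans (mul_le_mul_of_nonneg_left ?_
        (div_nonneg ENNReal.toReal_nonneg ENNReal.toReal_nonneg))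
      exact Real.rpow_le_rpow (one_add_length_pos L _).le (by linarith [length_pow_le L t n])
        (by positivity)
  exact_mod_cast this

open Measure in
/-- A group with rapid decay is unimodular. -/
theorem isMulRightInvariant_of_rapidDecay {μ : Measure G} [μ.IsHaarMeasure] [μ.Regular]
    {L : LengthFunction G} {d : ℝ} (hd : 0 ≤ d) {C : NNReal}
    (hC : ∀ f g : C_c(G, ℂ), eLpNorm (groupConv μ f g) 2 μ ≤
      C * eLpNorm f 2 (weightedMeasure μ L 2 d) * eLpNorm g 2 μ) : μ.IsMulRightInvariant := by
  refine ⟨fun t => ?_⟩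
  rw [map_mul_right_eq_smul]
  have h1 := modularCharacterFun_le_one hd hC t
  have h2 := modularCharacterFun_le_one hd hC t⁻¹
  have h3 : modularCharacterFun t * modularCharacterFun t⁻¹ = 1 := by
    rw [← modularCharacterFun_map_mul, mul_inv_cancel, modularCharacterFun_map_one]
  have h4 : modularCharacterFun t = 1 := by
    refine le_antisymm h1 ?_
    rw [← h3]
    exact mul_le_of_le_one_right' h2
  rw [h4, one_smul]

open Measure in
/-- A regular bi-invariant Haar measure is invariant under inversion. -/
theorem isInvInvariant_of_isMulRightInvariant (μ : Measure G) [μ.IsHaarMeasure] [μ.Regular]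
    [μ.IsMulRightInvariant] : μ.IsInvInvariant := by
  constructor
  let c : ℝ≥0∞ := haarScalarFactor μ.inv μ
  have hc : μ.inv = c • μ := isMulLeftInvariant_eq_smul_of_regular μ.inv μ
  -- Inverting twice is the identity, so the proportionality constant satisfies `c ^ 2 = 1`.
  have : Measure.map Inv.inv (Measure.map Inv.inv μ) = c ^ 2 • μ := by
    rw [← inv_def μ, hc, Measure.map_smul, ← inv_def μ, hc, smul_smul, pow_two]
  have μeq : μ = c ^ 2 • μ := by
    rw [map_map continuous_inv.measurable continuous_inv.measurable] at this
    simpa only [inv_involutive, Function.Involutive.comp_self, Measure.map_id]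
  have K : TopologicalSpace.PositiveCompacts G := Classical.arbitrary _
  have : c ^ 2 * μ K = 1 ^ 2 * μ K := by
    conv_rhs => rw [μeq]
    simp
  have : c ^ 2 = 1 ^ 2 :=
    (ENNReal.mul_left_inj (measure_pos_of_nonempty_interior _ K.interior_nonempty).ne'
          K.isCompact.measure_lt_top.ne).1 this
  have : c = 1 := (ENNReal.pow_right_strictMono two_ne_zero).injective this
  rw [hc, this, one_smul]

end Unimodular

/-! ### Reflection, density of `C_c(G)` in weighted spaces, and extension of bounds -/

section Approximation

open Filter Topology

variable {G : Type*} [Group G] [TopologicalSpace G] [IsTopologicalGroup G]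
  [LocallyCompactSpace G] [T2Space G] [MeasurableSpace G] [BorelSpace G]

/-- The substitution `t ↦ s⁻¹ t` in the right-hand integral; left invariance is enough. -/
theorem groupConv_apply_eq_reflect (μ : Measure G) [μ.IsMulLeftInvariant] (f g : G → ℂ) (s : G) :
    groupConv μ f g s = groupConv μ (fun t => g t⁻¹) (fun t => f t⁻¹) s⁻¹ := by
  have := integral_mul_left_eq_self (μ := μ) (fun t => g t⁻¹ * f (s * t)) s⁻¹
  simp only [mul_inv_rev, inv_inv, mul_inv_cancel_left] at this
  simp only [groupConv, mul_inv_rev, inv_inv]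
  rw [← this]
  simp [mul_comm]

theorem eLpNorm_comp_inv (μ : Measure G) [μ.IsInvInvariant] (f : G → ℂ)
    (hf : AEStronglyMeasurable f μ) (r : ℝ≥0∞) :
    eLpNorm (fun s => f s⁻¹) r μ = eLpNorm f r μ :=
  eLpNorm_comp_measurePreserving (g := f) hf (Measure.measurePreserving_inv μ)

theorem eLpNorm_weightedMeasure_eq (L : LengthFunction G) (μ : Measure G) {r : ℝ≥0∞}
    (h0 : r ≠ 0) (ht : r ≠ ∞) (d : ℝ) (f : G → ℂ) :
    eLpNorm f r (weightedMeasure μ L r d) = eLpNorm (fun s => (polyWeight L d s : ℂ) * f s) r μ := by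
  have hr := ENNReal.toReal_pos h0 ht
  refine (ENNReal.rpow_left_injective hr.ne') ?_
  simp only
  rw [eLpNorm_weightedMeasure_rpow L μ h0 ht, eLpNorm_rpow_eq_lintegral _ h0 ht]
  refine lintegral_congr fun s => ?_
  have hp := polyWeight_pos L d s
  rw [enorm_mul, ENNReal.mul_rpow_of_nonneg _ _ hr.le]
  congr 1
  rw [← ofReal_norm, Complex.norm_real, Real.norm_of_nonneg hp.le,
    ENNReal.ofReal_rpow_of_pos hp, polyWeight, polyWeight, mul_comm r.toReal,
    Real.rpow_mul (one_add_length_pos L s).le]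

theorem eLpNorm_le_eLpNorm_weightedMeasure (L : LengthFunction G) (μ : Measure G) (r : ℝ≥0∞)
    {d : ℝ} (hd : 0 ≤ d) (f : G → ℂ) :
    eLpNorm f r μ ≤ eLpNorm f r (weightedMeasure μ L r d) := by
  have h := weightedMeasure_mono L μ r hd
  rw [weightedMeasure_zero] at h
  exact eLpNorm_mono_measure f h

theorem memLp_of_weightedMeasure {L : LengthFunction G} {μ : Measure G} {r : ℝ≥0∞}
    {d : ℝ} (hd : 0 ≤ d) {f : G → ℂ} (hf : MemLp f r (weightedMeasure μ L r d)) :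
    MemLp f r μ :=
  ⟨hf.1.mono_ac (absolutelyContinuous_weightedMeasure L μ r d),
    (eLpNorm_le_eLpNorm_weightedMeasure L μ r hd f).trans_lt hf.2⟩

theorem exists_cc_eLpNorm_sub_indicator_le (μ : Measure G) [μ.IsHaarMeasure] [μ.Regular]
    {r : ℝ≥0∞} (ht : r ≠ ∞) (c : ℂ) {t : Set G} (hm : MeasurableSet t) (htμ : μ t < ∞) {ε : ℝ≥0∞}
    (hε : ε ≠ 0) :
    ∃ f : G → ℂ, eLpNorm (f - t.indicator fun _ => c) r μ ≤ ε ∧ Continuous f ∧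
      HasCompactSupport f := by
  rcases exists_Lp_half ℂ μ r hε with ⟨δ, δpos, hδ⟩
  obtain ⟨η, ηpos, hη⟩ :
      ∃ η : NNReal, 0 < η ∧ ∀ s : Set G, μ s ≤ η → eLpNorm (s.indicator fun _ => c) r μ ≤ δ :=
    exists_eLpNorm_indicator_le ht c δpos.ne'
  have hη_pos' : (0 : ℝ≥0∞) < η := ENNReal.coe_pos.2 ηpos
  obtain ⟨s, st, s_compact, s_closed, μs⟩ :
      ∃ s, s ⊆ t ∧ IsCompact s ∧ IsClosed s ∧ μ (t \ s) < η :=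
    hm.exists_isCompact_isClosed_sdiff_lt htμ.ne hη_pos'.ne'
  have hsμ : μ s ≠ ∞ := ((measure_mono st).trans_lt htμ).ne
  have I1 : eLpNorm ((s.indicator fun _ => c) - t.indicator fun _ => c) r μ ≤ δ := by
    rw [← eLpNorm_neg, neg_sub, ← Set.indicator_sdiff st]
    exact hη _ μs.le
  obtain ⟨V, sV, V_open, -, hV⟩ : ∃ V : Set G, V ⊇ s ∧ IsOpen V ∧ μ V < ∞ ∧ μ (V \ s) < η :=
    s_closed.measurableSet.exists_isOpen_sdiff_lt hsμ hη_pos'.ne'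
  obtain ⟨φ, hφ1, hφ0, hφc, hφ01⟩ := exists_continuous_one_zero_of_isCompact s_compact
    V_open.isClosed_compl (Set.disjoint_compl_right_iff_subset.2 sV)
  have hcont : Continuous (fun x => φ x • c) := by fun_prop
  have I2 : eLpNorm ((fun x => φ x • c) - s.indicator fun _ => c) r μ ≤ δ := by
    refine (eLpNorm_mono fun x => ?_).trans (hη (V \ s) hV.le)
    by_cases hs : x ∈ s
    · simp [hs, hφ1 hs]
    by_cases hv : x ∈ V
    · simpa [hs, hv, abs_of_nonneg (hφ01 x).1] using
        mul_le_of_le_one_left (norm_nonneg c) (hφ01 x).2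
    · simp [hs, hv, hφ0 hv]
  refine ⟨fun x => φ x • c, ?_, hcont, hφc.smul_right⟩
  have h := (hδ _ _ (hcont.aestronglyMeasurable.sub
    (aestronglyMeasurable_const.indicator s_closed.measurableSet))
    ((aestronglyMeasurable_const.indicator s_closed.measurableSet).sub
      (aestronglyMeasurable_const.indicator hm)) I2 I1).le
  rwa [sub_add_sub_cancel] at h

/-- Compactly supported continuous functions are dense in `L^r(G)`. -/
theorem exists_cc_eLpNorm_sub_le (μ : Measure G) [μ.IsHaarMeasure] [μ.Regular] {r : ℝ≥0∞}
    (ht : r ≠ ∞) {x : G → ℂ} (hx : MemLp x r μ) {ε : ℝ≥0∞} (hε : ε ≠ 0) :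
    ∃ h : C_c(G, ℂ), eLpNorm (x - ⇑h) r μ ≤ ε := by
  obtain ⟨h, hle, hcont, hc⟩ := hx.induction_dense ht
    (fun f => Continuous f ∧ HasCompactSupport f)
    (fun c t hm htμ ε hε => exists_cc_eLpNorm_sub_indicator_le μ ht c hm htμ hε)
    (fun f g hf hg => ⟨hf.1.add hg.1, hf.2.add hg.2⟩)
    (fun f hf => hf.1.aestronglyMeasurable) hε
  exact ⟨⟨⟨h, hcont⟩, hc⟩, hle⟩

/-- The weight is only Borel, so regularity of the weighted measure is bypassed. Approximating `ω x`
by `k` without weight shows that cutting `x` off outside the support of `k` costs little: there the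
difference is `ω x - k` itself. The truncated function lives on a compact set, near which the weight
is bounded, and unweighted approximation followed by a cutoff suffices. -/
theorem exists_cc_eLpNorm_weightedMeasure_sub_le (μ : Measure G) [μ.IsHaarMeasure] [μ.Regular]
    (L : LengthFunction G) {r : ℝ≥0∞} (h1 : 1 ≤ r) (ht : r ≠ ∞) {d : ℝ} (hd : 0 ≤ d) {x : G → ℂ}
    (hx : MemLp x r (weightedMeasure μ L r d)) {ε : ℝ≥0∞} (hε : ε ≠ 0) :
    ∃ h : C_c(G, ℂ), eLpNorm (x - ⇑h) r (weightedMeasure μ L r d) ≤ ε := by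
  have h0 : r ≠ 0 := (one_pos.trans_le h1).ne'
  have hxμ := memLp_of_weightedMeasure hd hx
  have hw : Measurable (fun s => (polyWeight L d s : ℂ)) :=
    Complex.measurable_ofReal.comp (measurable_polyWeight L d)
  have hy : MemLp (fun s => (polyWeight L d s : ℂ) * x s) r μ :=
    ⟨hw.aestronglyMeasurable.mul hxμ.1, by
      rw [← eLpNorm_weightedMeasure_eq L μ h0 ht]; exact hx.2⟩
  obtain ⟨k, hk⟩ := exists_cc_eLpNorm_sub_le μ ht hy (ε := ε / 2) (by simp [hε])
  have hKc : IsCompact (tsupport k) := k.hasCompactSupport.isCompact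
  set z : G → ℂ := (tsupport k).indicator x with hz
  have hzm : MemLp z r μ := hxμ.indicator hKc.measurableSet
  obtain ⟨φ, hφ1, -, hφc, hφ01⟩ := exists_continuous_one_zero_of_isCompact hKc isClosed_empty
    (Set.disjoint_empty _)
  obtain ⟨M, hM⟩ := L.exists_bound_of_isCompact μ hφc.isCompact
  -- `N` bounds the weight on the support of the cutoff `φ`, and thereby the loss in passing to the
  -- weighted norm.
  set N : NNReal := Real.toNNReal ((1 + M) ^ d) with hN
  obtain ⟨k', hk'⟩ := exists_cc_eLpNorm_sub_le μ ht hzm (ε := ε / 2 / N)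
    (by simp [hε])
  let h : C_c(G, ℂ) := ⟨⟨fun s => (φ s : ℂ) * k' s, by fun_prop⟩, k'.hasCompactSupport.mul_left⟩
  have hh : ∀ s, h s = (φ s : ℂ) * k' s := fun _ => rfl
  refine ⟨h, ?_⟩
  have hsplit : x - ⇑h = (x - z) + (z - ⇑h) := by abel
  have hac := weightedMeasure_absolutelyContinuous L μ r d
  rw [hsplit]
  refine (eLpNorm_add_le ((hxμ.1.sub hzm.1).mono_ac hac)
    ((hzm.1.sub h.continuous.aestronglyMeasurable).mono_ac hac) h1).trans ?_
  rw [← ENNReal.add_halves ε]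
  refine add_le_add ?_ ?_
  · rw [eLpNorm_weightedMeasure_eq L μ h0 ht]
    refine (eLpNorm_mono fun s => ?_).trans hk
    by_cases hs : s ∈ tsupport k
    · simp [hz, hs]
    · simp [hz, hs, image_eq_zero_of_notMem_tsupport hs]
  · rw [eLpNorm_weightedMeasure_eq L μ h0 ht]
    have hle : eLpNorm (fun s => (polyWeight L d s : ℂ) * (z - ⇑h) s) r μ ≤
        (N : ℝ≥0∞) * eLpNorm (z - ⇑k') r μ := by
      refine eLpNorm_le_nnreal_smul_eLpNorm_of_ae_le_mul (ae_of_all _ fun s => ?_) r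
      rw [← NNReal.coe_le_coe]
      push_cast
      simp only [norm_mul, Complex.norm_real, Pi.sub_apply, hh]
      have hp := polyWeight_pos L d s
      rw [Real.norm_of_nonneg hp.le]
      have hzφ : z s - φ s * k' s = φ s * (z s - k' s) := by
        by_cases hs : s ∈ tsupport k
        · have : φ s = 1 := hφ1 hs
          simp [this]
        · simp [hz, hs]
      rw [hzφ, norm_mul, Complex.norm_real, Real.norm_of_nonneg (hφ01 s).1, ← mul_assoc]
      gcongr
      by_cases hs : s ∈ tsupport φ
      · rw [hN, Real.coe_toNNReal']
        refine le_max_of_le_left ?_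
        calc polyWeight L d s * φ s ≤ polyWeight L d s :=
              mul_le_of_le_one_right hp.le (hφ01 s).2
          _ ≤ (1 + M) ^ d := Real.rpow_le_rpow (one_add_length_pos L s).le
              (by linarith [hM s hs]) hd
      · rw [image_eq_zero_of_notMem_tsupport hs, mul_zero]
        exact NNReal.coe_nonneg _
    refine hle.trans ((mul_le_mul_right hk' _).trans ?_)
    exact ENNReal.mul_div_le

theorem exists_seq_cc_tendsto (μ : Measure G) [μ.IsHaarMeasure] [μ.Regular]
    (L : LengthFunction G) {r : ℝ≥0∞} (h1 : 1 ≤ r) (ht : r ≠ ∞) {d : ℝ} (hd : 0 ≤ d) {x : G → ℂ}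
    (hx : MemLp x r (weightedMeasure μ L r d)) :
    ∃ h : ℕ → C_c(G, ℂ),
      Tendsto (fun n => eLpNorm (x - ⇑(h n)) r (weightedMeasure μ L r d)) atTop (𝓝 0) := by
  choose h hh using fun n : ℕ => exists_cc_eLpNorm_weightedMeasure_sub_le μ L h1 ht hd hx
    (ε := (n : ℝ≥0∞)⁻¹) (by simp)
  exact ⟨h, tendsto_of_tendsto_of_tendsto_of_le_of_le tendsto_const_nhds
    ENNReal.tendsto_inv_nat_nhds_zero (fun _ => zero_le) hh⟩

theorem tendsto_ccToWeightedLp {μ : Measure G} [μ.IsHaarMeasure] [μ.Regular]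
    {L : LengthFunction G} {r : ℝ≥0∞} [Fact (1 ≤ r)] {d : ℝ}
    {x : WeightedLp μ L r d} {h : ℕ → C_c(G, ℂ)}
    (hh : Tendsto (fun n => eLpNorm (⇑x - ⇑(h n)) r (weightedMeasure μ L r d)) atTop (𝓝 0)) :
    Tendsto (fun n => ccToWeightedLp μ L r d (h n)) atTop (𝓝 x) := by
  rw [tendsto_iff_edist_tendsto_0]
  refine hh.congr fun n => ?_
  rw [edist_comm, Lp.edist_def]
  exact eLpNorm_congr_ae ((EventuallyEq.refl _ _).sub (MemLp.coeFn_toLp _).symm)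

theorem denseRange_ccToWeightedLp (μ : Measure G) [μ.IsHaarMeasure] [μ.Regular]
    (L : LengthFunction G) {r : ℝ≥0∞} [h1 : Fact (1 ≤ r)] (ht : r ≠ ∞) {d : ℝ} (hd : 0 ≤ d) :
    DenseRange (ccToWeightedLp μ L r d) := by
  intro x
  obtain ⟨h, hh⟩ := exists_seq_cc_tendsto μ L h1.out ht hd (Lp.memLp x)
  exact mem_closure_of_tendsto (tendsto_ccToWeightedLp hh)
    (Eventually.of_forall fun n => Set.mem_range_self _)

/-- The translates of the right factor in a convolution. -/
theorem memLp_conv_kernel (μ : Measure G) [μ.IsHaarMeasure] (g : C_c(G, ℂ)) (s : G) (r : ℝ≥0∞) :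
    MemLp (fun t => g (t⁻¹ * s)) r μ :=
  (Continuous.memLp_of_hasCompactSupport (by fun_prop)
    (g.hasCompactSupport.comp_homeomorph ((Homeomorph.inv G).trans (Homeomorph.mulRight s))))

theorem integrable_conv_kernel (μ : Measure G) [μ.IsHaarMeasure] {r : ℝ≥0∞} (h1 : 1 ≤ r)
    {x : G → ℂ} (hx : MemLp x r μ) (g : C_c(G, ℂ)) (s : G) :
    Integrable (fun t => x t * g (t⁻¹ * s)) μ := by
  have := ENNReal.HolderConjugate.conjExponent h1
  have : ENNReal.HolderConjugate (ENNReal.conjExponent r) r := this.symm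
  rw [← memLp_one_iff_integrable]
  have h := (memLp_conv_kernel μ g s (ENNReal.conjExponent r))
  have := hx.smul h (r := 1)
  refine MemLp.ae_eq (ae_of_all _ fun t => ?_) this
  simp [mul_comm]

/-- Each value of the convolution pairs the left factor with a fixed function in the dual exponent,
so `L^r` convergence gives convergence at every point. This is what makes Fatou's lemma applicable
below. -/
theorem tendsto_groupConv (μ : Measure G) [μ.IsHaarMeasure] {r : ℝ≥0∞} (h1 : 1 ≤ r) {x : G → ℂ}
    (hx : MemLp x r μ) {h : ℕ → G → ℂ} (hm : ∀ n, MemLp (h n) r μ)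
    (hh : Tendsto (fun n => eLpNorm (x - h n) r μ) atTop (𝓝 0)) (g : C_c(G, ℂ)) (s : G) :
    Tendsto (fun n => groupConv μ (h n) g s) atTop (𝓝 (groupConv μ x g s)) := by
  have := ENNReal.HolderConjugate.conjExponent h1
  have : ENNReal.HolderConjugate (ENNReal.conjExponent r) r := this.symm
  have hk := memLp_conv_kernel μ g s (ENNReal.conjExponent r)
  refine tendsto_integral_of_L1' _ (integrable_conv_kernel μ h1 hx g s).1
    (Eventually.of_forall fun n => integrable_conv_kernel μ h1 (hm n) g s) ?_
  have hlim := ENNReal.Tendsto.const_mul hh (Or.inr hk.2.ne)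
  rw [mul_zero] at hlim
  refine tendsto_of_tendsto_of_tendsto_of_le_of_le tendsto_const_nhds hlim
    (fun _ => zero_le) fun n => ?_
  refine le_trans (le_of_eq ?_) (eLpNorm_smul_le_mul_eLpNorm (hx.1.sub (hm n).1) hk.1 (r := 1))
  rw [← eLpNorm_neg]
  congr 1
  funext t
  simp only [Pi.neg_apply, Pi.sub_apply, Pi.smul_apply', smul_eq_mul]
  ring

/-- A bound for convolutions with a fixed right factor extends from compactly supported left
factors to all left factors. -/
theorem eLpNorm_groupConv_le_of_cc (μ : Measure G) [μ.IsHaarMeasure] [μ.Regular]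
    (L : LengthFunction G) {r : ℝ≥0∞} (h1 : 1 ≤ r) (ht : r ≠ ∞) {d : ℝ} (hd : 0 ≤ d) {x : G → ℂ}
    (hx : MemLp x r (weightedMeasure μ L r d)) (g : C_c(G, ℂ)) {r' B : ℝ≥0∞} (hB : B ≠ ∞)
    (H : ∀ h : C_c(G, ℂ), eLpNorm (groupConv μ h g) r' μ ≤
      B * eLpNorm h r (weightedMeasure μ L r d)) :
    eLpNorm (groupConv μ x g) r' μ ≤ B * eLpNorm x r (weightedMeasure μ L r d) := by
  obtain ⟨h, hh⟩ := exists_seq_cc_tendsto μ L h1 ht hd hx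
  have hxμ := memLp_of_weightedMeasure hd hx
  have hm : ∀ n, MemLp (h n) r μ := fun n =>
    (h n).continuous.memLp_of_hasCompactSupport (h n).hasCompactSupport
  have hhμ : Tendsto (fun n => eLpNorm (x - ⇑(h n)) r μ) atTop (𝓝 0) :=
    tendsto_of_tendsto_of_tendsto_of_le_of_le tendsto_const_nhds hh (fun _ => zero_le)
      fun n => eLpNorm_le_eLpNorm_weightedMeasure L μ r hd _
  refine ENNReal.le_of_forall_pos_le_add fun ε hε _ => ?_
  -- Fatou's lemma: the pointwise limit inherits the bound that holds eventually along the sequence.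
  refine Lp.eLpNorm_le_of_ae_tendsto (f := fun n => groupConv μ (h n) g) (u := atTop) ?_
    (fun n => (continuous_groupConv μ (locallyIntegrable_cc μ (h n)) g).aestronglyMeasurable)
    (ae_of_all _ fun s => tendsto_groupConv μ h1 hxμ hm hhμ g s)
  have hlim := ENNReal.Tendsto.const_mul hh (Or.inr hB)
  rw [mul_zero] at hlim
  filter_upwards [hlim.eventually (ge_mem_nhds (ENNReal.coe_pos.2 hε))] with n hn
  refine (H (h n)).trans (le_trans ?_ (add_le_add_right hn _))
  rw [← mul_add]
  gcongr
  have : ⇑(h n) = x - (x - ⇑(h n)) := by abel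
  conv_lhs => rw [this]
  refine eLpNorm_sub_le hx.1 (hx.1.sub (memLp_weightedMeasure μ L r d (h n)).1) h1

end Approximation

/-! ### The convolution algebra `C_c(G)` and the `L¹` endpoint -/

section ConvCc

variable {G : Type*} [Group G] [TopologicalSpace G] [IsTopologicalGroup G]
  [LocallyCompactSpace G] [T2Space G] [MeasurableSpace G] [BorelSpace G]

open scoped Pointwise in
theorem hasCompactSupport_groupConv (μ : Measure G) (f g : C_c(G, ℂ)) :
    HasCompactSupport (groupConv μ f g) := by
  refine HasCompactSupport.intro
    (f.hasCompactSupport.isCompact.mul g.hasCompactSupport.isCompact) fun s hs => ?_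
  have : ∀ t, f t * g (t⁻¹ * s) = 0 := fun t => by
    by_contra h
    exact hs ⟨t, subset_tsupport _ (left_ne_zero_of_mul h), t⁻¹ * s,
      subset_tsupport _ (right_ne_zero_of_mul h), by simp⟩
  simp [groupConv, this]

/-- Convolution of compactly supported continuous functions. -/
noncomputable def ccConv (μ : Measure G) [μ.IsHaarMeasure] (f g : C_c(G, ℂ)) : C_c(G, ℂ) :=
  ⟨⟨groupConv μ f g, continuous_groupConv μ (locallyIntegrable_cc μ f) g⟩,
    hasCompactSupport_groupConv μ f g⟩

@[simp] theorem coe_ccConv (μ : Measure G) [μ.IsHaarMeasure] (f g : C_c(G, ℂ)) :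
    ⇑(ccConv μ f g) = groupConv μ f g := rfl

theorem integrable_cc (μ : Measure G) [IsFiniteMeasureOnCompacts μ] (f : C_c(G, ℂ)) :
    Integrable f μ :=
  f.continuous.integrable_of_hasCompactSupport f.hasCompactSupport

open scoped Pointwise in
theorem ccConv_assoc (μ : Measure G) [μ.IsHaarMeasure] (f g h : C_c(G, ℂ)) :
    ccConv μ (ccConv μ f g) h = ccConv μ f (ccConv μ g h) := by
  ext s
  simp only [coe_ccConv, groupConv]
  simp_rw [← integral_mul_const, ← integral_const_mul]
  rw [integral_integral_swap_of_hasCompactSupport]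
  · refine integral_congr_ae (Filter.Eventually.of_forall fun u => ?_)
    have := integral_mul_left_eq_self (μ := μ) (fun t => f u * g (u⁻¹ * t) * h (t⁻¹ * s)) u
    simp only [inv_mul_cancel_left] at this
    simp only [← this]
    refine integral_congr_ae (Filter.Eventually.of_forall fun t => ?_)
    simp [mul_assoc]
  · simp only [Function.uncurry_def]
    fun_prop
  · refine HasCompactSupport.intro ((f.hasCompactSupport.isCompact.mul
      g.hasCompactSupport.isCompact).prod f.hasCompactSupport.isCompact) ?_
    rintro ⟨t, u⟩ hs
    by_contra hne
    have hne' : f u * g (u⁻¹ * t) * h (t⁻¹ * s) ≠ 0 := hne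
    have h1 := left_ne_zero_of_mul hne'
    have hu : u ∈ tsupport f := subset_tsupport _ (left_ne_zero_of_mul h1)
    exact hs ⟨⟨u, hu, u⁻¹ * t, subset_tsupport _ (right_ne_zero_of_mul h1), by simp⟩, hu⟩

open scoped Pointwise in
-- Fubini. As `G` need not be σ-compact, the order of integration is exchanged for a continuous
-- integrand of compact support, where no σ-finiteness is required.
theorem eLpNorm_one_groupConv_cc_le (μ : Measure G) [μ.IsHaarMeasure] (f g : C_c(G, ℂ)) :
    eLpNorm (groupConv μ f g) 1 μ ≤ eLpNorm g 1 μ * eLpNorm f 1 μ := by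
  have hc := integrable_cc μ (ccConv μ f g)
  rw [coe_ccConv] at hc
  rw [eLpNorm_one_eq_lintegral_enorm, eLpNorm_one_eq_lintegral_enorm,
    eLpNorm_one_eq_lintegral_enorm, ← ofReal_integral_norm_eq_lintegral_enorm hc,
    ← ofReal_integral_norm_eq_lintegral_enorm (integrable_cc μ f),
    ← ofReal_integral_norm_eq_lintegral_enorm (integrable_cc μ g),
    ← ENNReal.ofReal_mul (integral_nonneg fun _ => norm_nonneg _)]
  refine ENNReal.ofReal_le_ofReal ?_
  have hK : HasCompactSupport (Function.uncurry fun s t : G => ‖f t‖ * ‖g (t⁻¹ * s)‖) := by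
    refine HasCompactSupport.intro ((f.hasCompactSupport.isCompact.mul
      g.hasCompactSupport.isCompact).prod f.hasCompactSupport.isCompact) ?_
    rintro ⟨s, t⟩ hs
    by_contra hne
    have hne' : ‖f t‖ * ‖g (t⁻¹ * s)‖ ≠ 0 := hne
    have ht : t ∈ tsupport f :=
      subset_tsupport _ (norm_ne_zero_iff.1 (left_ne_zero_of_mul hne'))
    exact hs ⟨⟨t, ht, t⁻¹ * s,
      subset_tsupport _ (norm_ne_zero_iff.1 (right_ne_zero_of_mul hne')), by simp⟩, ht⟩
  have hcont : Continuous (Function.uncurry fun s t : G => ‖f t‖ * ‖g (t⁻¹ * s)‖) := by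
    simp only [Function.uncurry_def]
    fun_prop
  have hswap := integral_integral_swap_of_hasCompactSupport hcont hK (μ := μ) (ν := μ)
  have hle : ∀ s, ‖groupConv μ f g s‖ ≤ ∫ t, ‖f t‖ * ‖g (t⁻¹ * s)‖ ∂μ := fun s => by
    refine (norm_integral_le_integral_norm _).trans_eq ?_
    simp_rw [norm_mul]
  calc ∫ s, ‖groupConv μ f g s‖ ∂μ ≤ ∫ s, ∫ t, ‖f t‖ * ‖g (t⁻¹ * s)‖ ∂μ ∂μ := by
        refine integral_mono_of_nonneg (ae_of_all _ fun _ => norm_nonneg _) ?_ (ae_of_all _ hle)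
        refine Continuous.integrable_of_hasCompactSupport ?_ ?_
        -- Continuity of the inner integral is read off from the convolution of `|f|` and `|g|`.
        · let f' : C_c(G, ℂ) := ⟨⟨fun s => (‖f s‖ : ℂ), by fun_prop⟩,
            f.hasCompactSupport.norm.comp_left Complex.ofReal_zero⟩
          let g' : C_c(G, ℂ) := ⟨⟨fun s => (‖g s‖ : ℂ), by fun_prop⟩,
            g.hasCompactSupport.norm.comp_left Complex.ofReal_zero⟩
          have h1 := continuous_groupConv μ (locallyIntegrable_cc μ f') g'
          have h2 : ∀ s, ∫ t, ‖f t‖ * ‖g (t⁻¹ * s)‖ ∂μ = (groupConv μ f' g' s).re := fun s => by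
            have : groupConv μ f' g' s = ((∫ t, ‖f t‖ * ‖g (t⁻¹ * s)‖ ∂μ : ℝ) : ℂ) := by
              rw [← integral_complex_ofReal]
              simp only [Complex.ofReal_mul]
              rfl
            rw [this, Complex.ofReal_re]
          simp_rw [h2]
          exact Complex.continuous_re.comp h1
        · refine HasCompactSupport.intro
            (f.hasCompactSupport.isCompact.mul g.hasCompactSupport.isCompact) fun s hs => ?_
          have : ∀ t, ‖f t‖ * ‖g (t⁻¹ * s)‖ = 0 := fun t => by
            by_contra h
            exact hs ⟨t, subset_tsupport _ (norm_ne_zero_iff.1 (left_ne_zero_of_mul h)), t⁻¹ * s,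
              subset_tsupport _ (norm_ne_zero_iff.1 (right_ne_zero_of_mul h)), by simp⟩
          simp [this]
    _ = ∫ t, ∫ s, ‖f t‖ * ‖g (t⁻¹ * s)‖ ∂μ ∂μ := hswap
    _ = (∫ s, ‖g s‖ ∂μ) * ∫ t, ‖f t‖ ∂μ := by
        simp_rw [integral_const_mul, integral_mul_left_eq_self (μ := μ) (fun s => ‖g s‖),
          integral_mul_const, mul_comm]
    _ = _ := rfl

theorem eLpNorm_one_groupConv_le (μ : Measure G) [μ.IsHaarMeasure] [μ.Regular]
    (L : LengthFunction G) {x : G → ℂ} (hx : MemLp x 1 μ) (g : C_c(G, ℂ)) :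
    eLpNorm (groupConv μ x g) 1 μ ≤ eLpNorm g 1 μ * eLpNorm x 1 μ := by
  have hg : MemLp g 1 μ := memLp_one_iff_integrable.2 (integrable_cc μ g)
  have := eLpNorm_groupConv_le_of_cc μ L le_rfl ENNReal.one_ne_top (d := 0) le_rfl (x := x)
    (by rwa [weightedMeasure_zero]) g (r' := 1) hg.2.ne
    (fun h => by rw [weightedMeasure_zero]; exact eLpNorm_one_groupConv_cc_le μ h g)
  rwa [weightedMeasure_zero] at this

/-- `|g|^a` as a compactly supported function. -/
noncomputable def ccNormPow (g : C_c(G, ℂ)) {a : ℝ} (ha : 0 < a) : C_c(G, ℂ) :=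
  ⟨⟨fun s => ((‖g s‖ ^ a : ℝ) : ℂ),
    Complex.continuous_ofReal.comp (g.continuous.norm.rpow_const fun _ => Or.inr ha.le)⟩,
    g.hasCompactSupport.comp_left (g := fun z : ℂ => ((‖z‖ ^ a : ℝ) : ℂ))
      (by simp [Real.zero_rpow ha.ne'])⟩

theorem enorm_ccNormPow (g : C_c(G, ℂ)) {a : ℝ} (ha : 0 < a) (s : G) :
    ‖ccNormPow g ha s‖ₑ = ‖g s‖ₑ ^ a := by
  have : ccNormPow g ha s = ((‖g s‖ ^ a : ℝ) : ℂ) := rfl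
  rw [this, ← ofReal_norm, ← ofReal_norm, Complex.norm_real, Real.norm_of_nonneg (by positivity),
    ENNReal.ofReal_rpow_of_nonneg (norm_nonneg _) ha.le]

/-- Convolutions of nonnegative functions are given by a lower integral. -/
theorem enorm_groupConv_of_nonneg (μ : Measure G) [μ.IsHaarMeasure] {r : ℝ≥0∞} (h1 : 1 ≤ r)
    {u : G → ℝ} (hu0 : ∀ t, 0 ≤ u t) (hu : MemLp (fun t => (u t : ℂ)) r μ) (g : C_c(G, ℂ)) {a : ℝ}
    (ha : 0 < a) (s : G) :
    ‖groupConv μ (fun t => (u t : ℂ)) (ccNormPow g ha) s‖ₑ =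
      ∫⁻ t, ENNReal.ofReal (u t) * ‖g (t⁻¹ * s)‖ₑ ^ a ∂μ := by
  have hint := integrable_conv_kernel μ h1 hu (ccNormPow g ha) s
  have h2 : groupConv μ (fun t => (u t : ℂ)) (ccNormPow g ha) s =
      ((∫ t, u t * ‖g (t⁻¹ * s)‖ ^ a ∂μ : ℝ) : ℂ) := by
    rw [← integral_complex_ofReal]
    simp only [Complex.ofReal_mul]
    rfl
  have hint' : Integrable (fun t => u t * ‖g (t⁻¹ * s)‖ ^ a) μ := by
    refine hint.re.congr (ae_of_all _ fun t => ?_)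
    have : (u t : ℂ) * ccNormPow g ha (t⁻¹ * s) = ((u t * ‖g (t⁻¹ * s)‖ ^ a : ℝ) : ℂ) := by
      rw [Complex.ofReal_mul]
      rfl
    simp only [this]
    exact Complex.ofReal_re _
  have hnn : ∀ t, 0 ≤ u t * ‖g (t⁻¹ * s)‖ ^ a := fun t =>
    mul_nonneg (hu0 t) (Real.rpow_nonneg (norm_nonneg _) _)
  rw [h2, ← ofReal_norm, Complex.norm_real, Real.norm_of_nonneg (integral_nonneg hnn),
    ofReal_integral_eq_lintegral_ofReal hint' (ae_of_all _ hnn)]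
  refine lintegral_congr fun t => ?_
  rw [ENNReal.ofReal_mul (hu0 t), ← ENNReal.ofReal_rpow_of_nonneg (norm_nonneg _) ha.le,
    ofReal_norm]

end ConvCc

/-! ### Interpolation by Hölder's inequality -/

section Interpolation

variable {G : Type*} [Group G] [TopologicalSpace G] [IsTopologicalGroup G]
  [LocallyCompactSpace G] [T2Space G] [MeasurableSpace G] [BorelSpace G]

theorem enorm_groupConv_le (μ : Measure G) (f g : G → ℂ) (s : G) :
    ‖groupConv μ f g s‖ₑ ≤ ∫⁻ t, ‖f t‖ₑ * ‖g (t⁻¹ * s)‖ₑ ∂μ := by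
  refine (enorm_integral_le_lintegral_enorm _).trans_eq ?_
  simp_rw [enorm_mul]

/-- The `L¹` endpoint `|f|^Q ω^{Qe}` in the factorization of `|f|`. -/
noncomputable def endpointOne (L : LengthFunction G) (f : G → ℂ) (Q e : ℝ) (t : G) : ℝ :=
  ‖f t‖ ^ Q * polyWeight L (Q * e) t

/-- The weighted `L²` endpoint `|f|^{Q/2} ω^{Qe/2 - d}` in the factorization of `|f|`. -/
noncomputable def endpointTwo (L : LengthFunction G) (f : G → ℂ) (Q e d : ℝ) (t : G) : ℝ :=
  ‖f t‖ ^ (Q / 2) * polyWeight L (Q * e / 2 - d) t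

theorem endpointOne_nonneg (L : LengthFunction G) (f : G → ℂ) (Q e : ℝ) (t : G) :
    0 ≤ endpointOne L f Q e t :=
  mul_nonneg (Real.rpow_nonneg (norm_nonneg _) _) (polyWeight_pos L _ _).le

theorem endpointTwo_nonneg (L : LengthFunction G) (f : G → ℂ) (Q e d : ℝ) (t : G) :
    0 ≤ endpointTwo L f Q e d t :=
  mul_nonneg (Real.rpow_nonneg (norm_nonneg _) _) (polyWeight_pos L _ _).le

theorem measurable_endpointOne (L : LengthFunction G) (f : C_c(G, ℂ)) (Q e : ℝ) :
    Measurable (endpointOne L f Q e) :=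
  (f.continuous.measurable.norm.pow_const _).mul (measurable_polyWeight L _)

theorem measurable_endpointTwo (L : LengthFunction G) (f : C_c(G, ℂ)) (Q e d : ℝ) :
    Measurable (endpointTwo L f Q e d) :=
  (f.continuous.measurable.norm.pow_const _).mul (measurable_polyWeight L _)

/-- The exponents of `|f|` add up to `Q(1 - θ) + Qθ/2 = 1`. Those of the weight add up to `eQ(1 -
θ/2) - dθ = e - dθ`, which vanishes exactly for `e = dθ`: this dictates the weight in the theorem.
-/
theorem enorm_eq_endpoints (L : LengthFunction G) (f : G → ℂ) {Q θ d : ℝ} (h0 : 0 ≤ θ)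
    (h1 : θ ≤ 1) (hQ0 : 0 ≤ Q) (hQ : Q * (1 - θ / 2) = 1) (t : G) :
    ‖f t‖ₑ = ENNReal.ofReal (endpointOne L f Q (d * θ) t) ^ (1 - θ) *
      ENNReal.ofReal (endpointTwo L f Q (d * θ) d t) ^ θ := by
  have hn := norm_nonneg (f t)
  have hw := one_add_length_pos L t
  rw [ENNReal.ofReal_rpow_of_nonneg (endpointOne_nonneg L f _ _ t) (by linarith),
    ENNReal.ofReal_rpow_of_nonneg (endpointTwo_nonneg L f _ _ _ t) h0,
    ← ENNReal.ofReal_mul (Real.rpow_nonneg (endpointOne_nonneg L f _ _ t) _), ← ofReal_norm]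
  congr 1
  rw [endpointOne, endpointTwo, polyWeight, polyWeight,
    Real.mul_rpow (by positivity) (by positivity), Real.mul_rpow (by positivity) (by positivity),
    ← Real.rpow_mul hn, ← Real.rpow_mul hn, ← Real.rpow_mul hw.le, ← Real.rpow_mul hw.le,
    mul_mul_mul_comm, ← Real.rpow_add_of_nonneg hn (mul_nonneg hQ0 (by linarith)) (by positivity),
    ← Real.rpow_add hw]
  have e1 : Q * (1 - θ) + Q / 2 * θ = 1 := by linarith
  have e2 : Q * (d * θ) * (1 - θ) + (Q * (d * θ) / 2 - d) * θ = 0 := by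
    linear_combination (d * θ) * hQ
  rw [e1, e2, Real.rpow_one, Real.rpow_zero, mul_one]

theorem lintegral_endpointOne (L : LengthFunction G) (μ : Measure G) {q : ℝ≥0∞} (h0 : q ≠ 0)
    (ht : q ≠ ∞) (f : G → ℂ) (e : ℝ) :
    ∫⁻ t, ENNReal.ofReal (endpointOne L f q.toReal e t) ∂μ =
      eLpNorm f q (weightedMeasure μ L q e) ^ q.toReal := by
  rw [eLpNorm_weightedMeasure_rpow L μ h0 ht]
  refine lintegral_congr fun t => ?_
  rw [endpointOne, mul_comm, ENNReal.ofReal_mul (polyWeight_pos L _ _).le,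
    ← ENNReal.ofReal_rpow_of_nonneg (norm_nonneg _) ENNReal.toReal_nonneg, ofReal_norm]

/-- The square of the second endpoint times `ω_{2d}` is the first endpoint. The slack `d' ≤ d` is
absorbed here, so the inclusion is needed only for some exponent `d'` below `d`. -/
theorem eLpNorm_endpointTwo_le (L : LengthFunction G) (μ : Measure G) (f : G → ℂ) {Q e d d' : ℝ}
    (hd : d' ≤ d) :
    eLpNorm (fun t => (endpointTwo L f Q e d t : ℂ)) 2 (weightedMeasure μ L 2 d') ^ (2 : ℝ) ≤
      ∫⁻ t, ENNReal.ofReal (endpointOne L f Q e t) ∂μ := by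
  have := eLpNorm_weightedMeasure_rpow L μ (r := 2) (by simp) (by simp) d'
    (fun t => (endpointTwo L f Q e d t : ℂ))
  rw [ENNReal.toReal_ofNat] at this
  rw [this]
  refine lintegral_mono fun t => ?_
  have hn := norm_nonneg (f t)
  have hw := one_add_length_pos L t
  rw [← ofReal_norm, Complex.norm_real, Real.norm_of_nonneg (endpointTwo_nonneg L f _ _ _ t),
    ENNReal.ofReal_rpow_of_nonneg (endpointTwo_nonneg L f _ _ _ t) zero_le_two,
    ← ENNReal.ofReal_mul (polyWeight_pos L _ _).le]
  refine ENNReal.ofReal_le_ofReal ?_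
  rw [endpointOne, endpointTwo, Real.mul_rpow (by positivity) (polyWeight_pos L _ _).le,
    ← Real.rpow_mul hn, div_mul_cancel₀ _ (two_ne_zero (α := ℝ)), mul_left_comm]
  refine mul_le_mul_of_nonneg_left ?_ (by positivity)
  rw [polyWeight, polyWeight, polyWeight, ← Real.rpow_mul hw.le, ← Real.rpow_add hw]
  exact Real.rpow_le_rpow_of_exponent_le (one_le_one_add_length L t) (by linarith)

/-- Hölder with exponents `1/(1 - θ)` and `1/θ`, stated for products of factorized functions. -/
theorem lintegral_mul_le_interpolation (μ : Measure G) {θ : ℝ} (h0 : 0 ≤ θ) (h1 : θ ≤ 1)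
    {a F₀ F₁ b k₀ k₁ : G → ℝ≥0∞} (hF₀ : Measurable F₀) (hF₁ : Measurable F₁) (hk₀ : Measurable k₀)
    (hk₁ : Measurable k₁) (ha : ∀ t, a t = F₀ t ^ (1 - θ) * F₁ t ^ θ)
    (hb : ∀ t, b t = k₀ t ^ (1 - θ) * k₁ t ^ θ) :
    ∫⁻ t, a t * b t ∂μ ≤
      (∫⁻ t, F₀ t * k₀ t ∂μ) ^ (1 - θ) * (∫⁻ t, F₁ t * k₁ t ∂μ) ^ θ := by
  refine le_trans (le_of_eq ?_) (ENNReal.lintegral_mul_norm_pow_le (hF₀.mul hk₀).aemeasurable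
    (hF₁.mul hk₁).aemeasurable (sub_nonneg.2 h1) h0 (by ring))
  refine lintegral_congr fun t => ?_
  simp only [Pi.mul_apply]
  rw [ha, hb, ENNReal.mul_rpow_of_nonneg _ _ (sub_nonneg.2 h1), ENNReal.mul_rpow_of_nonneg _ _ h0]
  ring

/-- The bound on convolution operators on `L²(G)` extends to all of `L²(G, ω_d)`. -/
theorem eLpNorm_two_groupConv_le {μ : Measure G} [μ.IsHaarMeasure] [μ.Regular]
    {L : LengthFunction G} {d : ℝ} (hd : 0 ≤ d) {C : NNReal}
    (hC : ∀ f g : C_c(G, ℂ), eLpNorm (groupConv μ f g) 2 μ ≤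
      C * eLpNorm f 2 (weightedMeasure μ L 2 d) * eLpNorm g 2 μ)
    {x : G → ℂ} (hx : MemLp x 2 (weightedMeasure μ L 2 d)) (g : C_c(G, ℂ)) :
    eLpNorm (groupConv μ x g) 2 μ ≤
      C * eLpNorm x 2 (weightedMeasure μ L 2 d) * eLpNorm g 2 μ := by
  have hg : MemLp g 2 μ := g.continuous.memLp_of_hasCompactSupport g.hasCompactSupport
  refine (eLpNorm_groupConv_le_of_cc μ L one_le_two ENNReal.ofNat_ne_top hd hx g
    (B := C * eLpNorm g 2 μ) (ENNReal.mul_ne_top ENNReal.coe_ne_top hg.2.ne)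
    fun h => (hC h g).trans_eq (by ring)).trans_eq (by ring)

theorem eLpNorm_ccNormPow_rpow (μ : Measure G) {r r' : ℝ≥0∞} (h0 : r ≠ 0) (ht : r ≠ ∞)
    (h0' : r' ≠ 0) (ht' : r' ≠ ∞) (g : C_c(G, ℂ)) {a : ℝ} (ha : 0 < a)
    (har : a * r.toReal = r'.toReal) :
    eLpNorm (ccNormPow g ha) r μ ^ r.toReal = eLpNorm g r' μ ^ r'.toReal := by
  rw [eLpNorm_rpow_eq_lintegral _ h0 ht, eLpNorm_rpow_eq_lintegral _ h0' ht']
  simp_rw [enorm_ccNormPow, ← ENNReal.rpow_mul, har]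

variable {μ : Measure G} [μ.IsHaarMeasure] [μ.Regular] {L : LengthFunction G}

theorem memLp_endpointOne (μ : Measure G) [μ.IsHaarMeasure] [μ.Regular] (L : LengthFunction G)
    {q : ℝ≥0∞} (h0 : q ≠ 0) (ht : q ≠ ∞) (f : C_c(G, ℂ)) (e : ℝ) :
    MemLp (fun t => (endpointOne L f q.toReal e t : ℂ)) 1 μ := by
  refine ⟨(Complex.measurable_ofReal.comp (measurable_endpointOne L f _ e)).aestronglyMeasurable,
    ?_⟩
  rw [eLpNorm_one_eq_lintegral_enorm]
  have : ∀ t, ‖(endpointOne L f q.toReal e t : ℂ)‖ₑ =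
      ENNReal.ofReal (endpointOne L f q.toReal e t) := fun t => by
    rw [← ofReal_norm, Complex.norm_real, Real.norm_of_nonneg (endpointOne_nonneg L f _ _ t)]
  simp_rw [this]
  rw [lintegral_endpointOne L μ h0 ht]
  exact ENNReal.rpow_lt_top_of_nonneg ENNReal.toReal_nonneg (memLp_weightedMeasure μ L q e f).2.ne

theorem memLp_endpointTwo (μ : Measure G) [μ.IsHaarMeasure] [μ.Regular] (L : LengthFunction G)
    {q : ℝ≥0∞} (h0 : q ≠ 0) (ht : q ≠ ∞) (f : C_c(G, ℂ)) (e : ℝ) {d d' : ℝ} (hd : d' ≤ d) :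
    MemLp (fun t => (endpointTwo L f q.toReal e d t : ℂ)) 2 (weightedMeasure μ L 2 d') := by
  refine ⟨(Complex.measurable_ofReal.comp
    (measurable_endpointTwo L f _ e d)).aestronglyMeasurable, ?_⟩
  have h1 := eLpNorm_endpointTwo_le L μ f (Q := q.toReal) (e := e) hd
  rw [lintegral_endpointOne L μ h0 ht] at h1
  refine (ENNReal.rpow_lt_top_iff_of_pos zero_lt_two).1 (h1.trans_lt ?_)
  exact ENNReal.rpow_lt_top_of_nonneg ENNReal.toReal_nonneg (memLp_weightedMeasure μ L q e f).2.ne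

/-- The square of the `L²` endpoint convolution. -/
theorem lintegral_endpointTwo_conv_le {d d' : ℝ} (hd0 : 0 ≤ d') (hd : d' ≤ d) {C : NNReal}
    (hC : ∀ f g : C_c(G, ℂ), eLpNorm (groupConv μ f g) 2 μ ≤
      C * eLpNorm f 2 (weightedMeasure μ L 2 d') * eLpNorm g 2 μ)
    {q r : ℝ≥0∞} (h0 : q ≠ 0) (ht : q ≠ ∞) (hr0 : r ≠ 0) (hrt : r ≠ ∞) (e : ℝ) (f g : C_c(G, ℂ))
    (ha : 0 < r.toReal / 2) :
    ∫⁻ s, ‖groupConv μ (fun t => (endpointTwo L f q.toReal e d t : ℂ))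
        (ccNormPow g ha) s‖ₑ ^ (2 : ℝ) ∂μ ≤
      (C : ℝ≥0∞) ^ (2 : ℝ) * eLpNorm f q (weightedMeasure μ L q e) ^ q.toReal *
        eLpNorm g r μ ^ r.toReal := by
  have h1 := eLpNorm_two_groupConv_le hd0 hC (memLp_endpointTwo μ L h0 ht f e hd) (ccNormPow g ha)
  have h2 := eLpNorm_rpow_eq_lintegral μ (r := 2) (by simp) (by simp)
    (groupConv μ (fun t => (endpointTwo L f q.toReal e d t : ℂ)) (ccNormPow g ha))
  have h3 := eLpNorm_ccNormPow_rpow μ (r := 2) (r' := r) (by simp) (by simp) hr0 hrt g ha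
    (by rw [ENNReal.toReal_ofNat]; ring)
  have h4 := eLpNorm_endpointTwo_le L μ f (Q := q.toReal) (e := e) hd
  rw [lintegral_endpointOne L μ h0 ht] at h4
  rw [ENNReal.toReal_ofNat] at h2 h3
  rw [← h2, ← h3]
  refine (ENNReal.rpow_le_rpow h1 zero_le_two).trans ?_
  rw [ENNReal.mul_rpow_of_nonneg _ _ zero_le_two, ENNReal.mul_rpow_of_nonneg _ _ zero_le_two]
  gcongr

/-- Convolution by `f` on `L^q(G)`, for `1 ≤ q ≤ 2`. -/
theorem eLpNorm_groupConv_le_of_le_two {d d' : ℝ} (hd0 : 0 ≤ d') (hd : d' ≤ d) {C : NNReal}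
    (hC : ∀ f g : C_c(G, ℂ), eLpNorm (groupConv μ f g) 2 μ ≤
      C * eLpNorm f 2 (weightedMeasure μ L 2 d') * eLpNorm g 2 μ)
    {q : ℝ≥0∞} {θ : ℝ} (hθ0 : 0 ≤ θ) (hθ1 : θ ≤ 1) (hq0 : q ≠ 0) (hqt : q ≠ ∞)
    (hq : q.toReal * (1 - θ / 2) = 1) (f g : C_c(G, ℂ)) :
    eLpNorm (groupConv μ f g) q μ ≤
      (C : ℝ≥0∞) ^ θ * eLpNorm f q (weightedMeasure μ L q (d * θ)) * eLpNorm g q μ := by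
  have hQ : 0 < q.toReal := ENNReal.toReal_pos hq0 hqt
  set Q := q.toReal with hQdef
  set F : G → ℂ := fun t => (endpointOne L f Q (d * θ) t : ℂ)
  set F' : G → ℂ := fun t => (endpointTwo L f Q (d * θ) d t : ℂ)
  have hQ2 : 0 < Q / 2 := by positivity
  have hF := memLp_endpointOne μ L hq0 hqt f (d * θ)
  have hF' := memLp_endpointTwo μ L hq0 hqt f (d * θ) hd
  have hF'μ := memLp_of_weightedMeasure hd0 hF'
  -- First Hölder, in the integration variable, with `|g| = (|g|^Q)^{1-θ} (|g|^{Q/2})^θ`.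
  have hpt : ∀ s, ‖groupConv μ f g s‖ₑ ≤
      ‖groupConv μ F (ccNormPow g hQ) s‖ₑ ^ (1 - θ) *
        ‖groupConv μ F' (ccNormPow g hQ2) s‖ₑ ^ θ := by
    intro s
    refine (enorm_groupConv_le μ f g s).trans ?_
    rw [enorm_groupConv_of_nonneg μ le_rfl (endpointOne_nonneg L f Q (d * θ)) hF g hQ s,
      enorm_groupConv_of_nonneg μ one_le_two (endpointTwo_nonneg L f Q (d * θ) d) hF'μ g hQ2 s]
    have hm : Measurable fun t => ‖g (t⁻¹ * s)‖ₑ :=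
      (g.continuous.comp (continuous_inv.mul continuous_const)).measurable.enorm
    refine lintegral_mul_le_interpolation μ hθ0 hθ1
      (measurable_endpointOne L f Q (d * θ)).ennreal_ofReal
      (measurable_endpointTwo L f Q (d * θ) d).ennreal_ofReal (hm.pow_const _) (hm.pow_const _)
      (enorm_eq_endpoints L f hθ0 hθ1 hQ.le hq) fun t => ?_
    rw [← ENNReal.rpow_mul, ← ENNReal.rpow_mul, ← ENNReal.rpow_add_of_nonneg _ _
      (mul_nonneg hQ.le (by linarith)) (mul_nonneg hQ2.le hθ0),
      show Q * (1 - θ) + Q / 2 * θ = 1 by linarith, ENNReal.rpow_one]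
  set X := eLpNorm f q (weightedMeasure μ L q (d * θ)) ^ Q with hX
  set Y := eLpNorm g q μ ^ Q with hY
  have hA : ∫⁻ s, ‖groupConv μ F (ccNormPow g hQ) s‖ₑ ∂μ ≤ X * Y := by
    rw [← eLpNorm_one_eq_lintegral_enorm]
    refine (eLpNorm_one_groupConv_le μ L hF _).trans ?_
    rw [mul_comm]
    refine mul_le_mul' (le_of_eq ?_) (le_of_eq ?_)
    · rw [hX, ← lintegral_endpointOne L μ hq0 hqt, eLpNorm_one_eq_lintegral_enorm]
      refine lintegral_congr fun t => ?_
      rw [← ofReal_norm, Complex.norm_real, Real.norm_of_nonneg (endpointOne_nonneg L f _ _ t)]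
    · have := eLpNorm_ccNormPow_rpow μ (r := 1) (r' := q) (by simp) (by simp) hq0 hqt g hQ (by simp [hQdef])
      simpa using this
  have hB := lintegral_endpointTwo_conv_le hd0 hd hC hq0 hqt hq0 hqt (d * θ) f g hQ2
  have hFc : Continuous (groupConv μ F (ccNormPow g hQ)) :=
    continuous_groupConv μ (hF.locallyIntegrable le_rfl) _
  have hF'c : Continuous (groupConv μ F' (ccNormPow g hQ2)) :=
    continuous_groupConv μ (hF'μ.locallyIntegrable one_le_two) _
  have hint : eLpNorm (groupConv μ f g) q μ ^ Q ≤ ((C : ℝ≥0∞) ^ θ) ^ Q * X * Y := by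
    rw [eLpNorm_rpow_eq_lintegral _ hq0 hqt]
    calc ∫⁻ s, ‖groupConv μ f g s‖ₑ ^ Q ∂μ
        ≤ ∫⁻ s, ‖groupConv μ F (ccNormPow g hQ) s‖ₑ ^ (Q * (1 - θ)) *
          (‖groupConv μ F' (ccNormPow g hQ2) s‖ₑ ^ (2 : ℝ)) ^ (Q * θ / 2) ∂μ := by
          refine lintegral_mono fun s => ?_
          refine (ENNReal.rpow_le_rpow (hpt s) hQ.le).trans_eq ?_
          rw [ENNReal.mul_rpow_of_nonneg _ _ hQ.le, ← ENNReal.rpow_mul, ← ENNReal.rpow_mul,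
            ← ENNReal.rpow_mul]
          congr 2 <;> ring
      -- Second Hölder, in `s`: the exponents `Q(1 - θ)` and `Qθ/2` sum to `1`, pairing the `L¹`
      -- norm of one convolution with the squared `L²` norm of the other.
      _ ≤ _ := ENNReal.lintegral_mul_norm_pow_le hFc.measurable.enorm.aemeasurable
          (hF'c.measurable.enorm.pow_const _).aemeasurable (mul_nonneg hQ.le (by linarith))
          (by positivity) (by linarith)
      _ ≤ (X * Y) ^ (Q * (1 - θ)) * ((C : ℝ≥0∞) ^ (2 : ℝ) * X * Y) ^ (Q * θ / 2) :=
          mul_le_mul' (ENNReal.rpow_le_rpow hA (mul_nonneg hQ.le (by linarith)))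
            (ENNReal.rpow_le_rpow hB (by positivity))
      _ = ((C : ℝ≥0∞) ^ (2 : ℝ)) ^ (Q * θ / 2) *
          ((X * Y) ^ (Q * (1 - θ)) * (X * Y) ^ (Q * θ / 2)) := by
          rw [mul_assoc _ X Y, ENNReal.mul_rpow_of_nonneg _ _ (z := Q * θ / 2) (by positivity)]
          ring
      _ = _ := by
          rw [← ENNReal.rpow_add_of_nonneg _ _ (mul_nonneg hQ.le (by linarith)) (by positivity),
            show Q * (1 - θ) + Q * θ / 2 = 1 by linarith, ENNReal.rpow_one, ← ENNReal.rpow_mul,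
            ← ENNReal.rpow_mul, mul_assoc]
          congr 2
          ring
  rw [hX, hY, ← ENNReal.mul_rpow_of_nonneg _ _ hQ.le, ← ENNReal.mul_rpow_of_nonneg _ _ hQ.le] at hint
  exact (ENNReal.rpow_le_rpow_iff hQ).1 hint

/-- Convolution by `f` on `L^p(G)`, for `2 ≤ p < ∞`. -/
theorem eLpNorm_groupConv_le_of_two_le {d d' : ℝ} (hd0 : 0 ≤ d') (hd : d' ≤ d) {C : NNReal}
    (hC : ∀ f g : C_c(G, ℂ), eLpNorm (groupConv μ f g) 2 μ ≤
      C * eLpNorm f 2 (weightedMeasure μ L 2 d') * eLpNorm g 2 μ)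
    {p q : ℝ≥0∞} {θ : ℝ} (hθ0 : 0 ≤ θ) (hθ1 : θ ≤ 1) (hq0 : q ≠ 0) (hqt : q ≠ ∞)
    (hq : q.toReal * (1 - θ / 2) = 1) (hp0 : p ≠ 0) (hpt : p ≠ ∞) (hp : p.toReal * θ = 2)
    (f g : C_c(G, ℂ)) :
    eLpNorm (groupConv μ f g) p μ ≤
      (C : ℝ≥0∞) ^ θ * eLpNorm f q (weightedMeasure μ L q (d * θ)) * eLpNorm g p μ := by
  have hQ : 0 < q.toReal := ENNReal.toReal_pos hq0 hqt
  have hP : 0 < p.toReal := ENNReal.toReal_pos hp0 hpt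
  set Q := q.toReal with hQdef
  set P := p.toReal with hPdef
  set F' : G → ℂ := fun t => (endpointTwo L f Q (d * θ) d t : ℂ)
  have hP2 : 0 < P / 2 := by positivity
  have hF' := memLp_endpointTwo μ L hq0 hqt f (d * θ) hd
  have hF'μ := memLp_of_weightedMeasure hd0 hF'
  set X := eLpNorm f q (weightedMeasure μ L q (d * θ)) ^ Q with hX
  set Y := eLpNorm g p μ ^ P with hY
  have hXt : X ≠ ∞ := ENNReal.rpow_ne_top_of_nonneg hQ.le (memLp_weightedMeasure μ L q _ f).2.ne
  -- The first endpoint is now `L^∞`: since `Pθ = 2`, `|g| = 1^{1-θ} (|g|^{P/2})^θ`, and the first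
  -- factor integrates to the constant `X`.
  have hpt : ∀ s, ‖groupConv μ f g s‖ₑ ≤
      X ^ (1 - θ) * ‖groupConv μ F' (ccNormPow g hP2) s‖ₑ ^ θ := by
    intro s
    refine (enorm_groupConv_le μ f g s).trans ?_
    rw [enorm_groupConv_of_nonneg μ one_le_two (endpointTwo_nonneg L f Q (d * θ) d) hF'μ g hP2 s,
      hX, ← lintegral_endpointOne L μ hq0 hqt]
    have hm : Measurable fun t => ‖g (t⁻¹ * s)‖ₑ :=
      (g.continuous.comp (continuous_inv.mul continuous_const)).measurable.enorm
    refine (lintegral_mul_le_interpolation μ hθ0 hθ1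
      (measurable_endpointOne L f Q (d * θ)).ennreal_ofReal
      (measurable_endpointTwo L f Q (d * θ) d).ennreal_ofReal (k₀ := fun _ => 1) measurable_const
      (k₁ := fun t => ‖g (t⁻¹ * s)‖ₑ ^ (P / 2)) (hm.pow_const _)
      (enorm_eq_endpoints L f hθ0 hθ1 hQ.le hq) fun t => ?_).trans_eq
      (by simp only [mul_one, hQdef])
    rw [ENNReal.one_rpow, one_mul, ← ENNReal.rpow_mul,
      show P / 2 * θ = 1 by linarith, ENNReal.rpow_one]
  have hB := lintegral_endpointTwo_conv_le hd0 hd hC hq0 hqt hp0 ‹p ≠ ∞› (d * θ) f g hP2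
  have hint : eLpNorm (groupConv μ f g) p μ ^ P ≤ ((C : ℝ≥0∞) ^ θ) ^ P *
      eLpNorm f q (weightedMeasure μ L q (d * θ)) ^ P * Y := by
    rw [eLpNorm_rpow_eq_lintegral _ hp0 ‹p ≠ ∞›]
    have hθP : 0 ≤ (1 - θ) * P := mul_nonneg (by linarith) hP.le
    calc ∫⁻ s, ‖groupConv μ f g s‖ₑ ^ P ∂μ
        ≤ ∫⁻ s, X ^ ((1 - θ) * P) * ‖groupConv μ F' (ccNormPow g hP2) s‖ₑ ^ (2 : ℝ) ∂μ := by
          refine lintegral_mono fun s => ?_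
          refine (ENNReal.rpow_le_rpow (hpt s) hP.le).trans_eq ?_
          rw [ENNReal.mul_rpow_of_nonneg _ _ hP.le, ← ENNReal.rpow_mul X,
            ← ENNReal.rpow_mul ‖_‖ₑ, show θ * P = 2 by linarith]
      _ = X ^ ((1 - θ) * P) * ∫⁻ s, ‖groupConv μ F' (ccNormPow g hP2) s‖ₑ ^ (2 : ℝ) ∂μ :=
          lintegral_const_mul' _ _ (ENNReal.rpow_ne_top_of_nonneg hθP hXt)
      _ ≤ X ^ ((1 - θ) * P) * ((C : ℝ≥0∞) ^ (2 : ℝ) * X * Y) := by gcongr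
      _ = (C : ℝ≥0∞) ^ (2 : ℝ) * (X ^ ((1 - θ) * P) * X ^ (1 : ℝ)) * Y := by
          rw [ENNReal.rpow_one]
          ring
      _ = _ := by
          rw [← ENNReal.rpow_add_of_nonneg _ _ hθP zero_le_one, hX, ← ENNReal.rpow_mul,
            ← ENNReal.rpow_mul, show θ * P = 2 by linarith]
          congr 3
          -- The norm of `f` occurs to the power `Q((1 - θ)P + 1)`, which equals `P`.
          linear_combination P * hq - Q * hp / 2
  rw [hY, ← ENNReal.mul_rpow_of_nonneg _ _ hP.le, ← ENNReal.mul_rpow_of_nonneg _ _ hP.le] at hint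
  exact (ENNReal.rpow_le_rpow_iff hP).1 hint

end Interpolation

/-! ### Transfer of bounds in the unimodular case and the weighted algebra inequality -/

section Bounds

variable {G : Type*} [Group G] [TopologicalSpace G] [IsTopologicalGroup G]
  [LocallyCompactSpace G] [T2Space G] [MeasurableSpace G] [BorelSpace G]
  (μ : Measure G) [μ.IsHaarMeasure] [μ.Regular] [μ.IsMulRightInvariant] [μ.IsInvInvariant]

theorem measurePreserving_inv_mul (s : G) : MeasurePreserving (fun t => t⁻¹ * s) μ μ :=
  (measurePreserving_mul_right μ s).comp (Measure.measurePreserving_inv μ)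

theorem memLp_comp_inv {r : ℝ≥0∞} {g : G → ℂ} (hg : MemLp g r μ) :
    MemLp (fun t => g t⁻¹) r μ :=
  hg.comp_measurePreserving (Measure.measurePreserving_inv μ)

theorem groupConv_eq_reflect (f : C_c(G, ℂ)) (g : G → ℂ) :
    groupConv μ f g = fun s => groupConv μ (fun t => g t⁻¹) (ccInv f) s⁻¹ :=
  funext fun s => groupConv_apply_eq_reflect μ f g s

theorem continuous_groupConv_left (f : C_c(G, ℂ)) {r : ℝ≥0∞} (h1 : 1 ≤ r) {g : G → ℂ}
    (hg : MemLp g r μ) : Continuous (groupConv μ f g) := by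
  rw [groupConv_eq_reflect]
  exact (continuous_groupConv μ ((memLp_comp_inv μ hg).locallyIntegrable h1) _).comp continuous_inv

theorem integrable_conv_kernel_left (f : C_c(G, ℂ)) {r : ℝ≥0∞} (h1 : 1 ≤ r) {g : G → ℂ}
    (hg : MemLp g r μ) (s : G) : Integrable (fun t => f t * g (t⁻¹ * s)) μ := by
  have := ENNReal.HolderConjugate.conjExponent h1
  have : ENNReal.HolderConjugate (ENNReal.conjExponent r) r := this.symm
  have hf : MemLp f (ENNReal.conjExponent r) μ :=
    f.continuous.memLp_of_hasCompactSupport f.hasCompactSupport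
  rw [← memLp_one_iff_integrable]
  exact (hg.comp_measurePreserving (measurePreserving_inv_mul μ s)).smul hf (r := 1)

/-- A bound for convolutions with a fixed left factor extends from compactly supported right
factors to all of `L^r(G)`. -/
theorem eLpNorm_groupConv_left_le_of_cc (L : LengthFunction G) {r : ℝ≥0∞} (h1 : 1 ≤ r)
    (ht : r ≠ ∞) (f : C_c(G, ℂ)) {B : ℝ≥0∞} (hB : B ≠ ∞)
    (H : ∀ g : C_c(G, ℂ), eLpNorm (groupConv μ f g) r μ ≤ B * eLpNorm g r μ)
    {g : G → ℂ} (hg : MemLp g r μ) :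
    eLpNorm (groupConv μ f g) r μ ≤ B * eLpNorm g r μ := by
  have hg' := memLp_comp_inv μ hg
  have := eLpNorm_groupConv_le_of_cc μ L h1 ht (d := 0) le_rfl (x := fun t => g t⁻¹)
    (by rwa [weightedMeasure_zero]) (ccInv f) (r' := r) hB fun h => by
      have h2 := H (ccInv h)
      rw [groupConv_eq_reflect] at h2
      simp only [ccInv_apply, inv_inv] at h2
      rw [eLpNorm_comp_inv μ (groupConv μ h (ccInv f))
        (continuous_groupConv μ (locallyIntegrable_cc μ h) _).aestronglyMeasurable] at h2
      rw [weightedMeasure_zero]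
      exact h2.trans_eq
        (congrArg _ (eLpNorm_comp_inv μ h h.continuous.aestronglyMeasurable r))
  rw [weightedMeasure_zero, eLpNorm_comp_inv μ g hg.1] at this
  rw [groupConv_eq_reflect, eLpNorm_comp_inv μ _
    (continuous_groupConv μ (hg'.locallyIntegrable h1) _).aestronglyMeasurable]
  exact this

/-- Serves the case `p = ∞`, where `C_c(G)` is not dense in general and the bound must be proved for
every `g` directly. Invariance under `t ↦ t⁻¹ s` carries the essential bound on `g` over to the
integrand. -/
theorem eLpNorm_top_groupConv_le (f : C_c(G, ℂ)) (g : G → ℂ) :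
    eLpNorm (groupConv μ f g) ∞ μ ≤ eLpNorm f 1 μ * eLpNorm g ∞ μ := by
  rw [eLpNorm_exponent_top (f := groupConv μ f g)]
  refine eLpNormEssSup_le_of_ae_enorm_bound (ae_of_all _ fun s => ?_)
  refine (enorm_groupConv_le μ f g s).trans ?_
  have hm : Measurable fun t => ‖f t‖ₑ := f.continuous.measurable.enorm
  rw [eLpNorm_one_eq_lintegral_enorm, eLpNorm_exponent_top, ← lintegral_mul_const _ hm]
  refine lintegral_mono_ae ?_
  filter_upwards [(measurePreserving_inv_mul μ s).quasiMeasurePreserving.ae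
    (ae_le_eLpNormEssSup (f := g))] with t ht
  gcongr

theorem eLpNorm_weightedMeasure_ccInv (L : LengthFunction G) {r : ℝ≥0∞} (h0 : r ≠ 0) (ht : r ≠ ∞)
    (e : ℝ) (f : C_c(G, ℂ)) :
    eLpNorm (ccInv f) r (weightedMeasure μ L r e) = eLpNorm f r (weightedMeasure μ L r e) := by
  rw [eLpNorm_weightedMeasure_eq L μ h0 ht, eLpNorm_weightedMeasure_eq L μ h0 ht]
  have hw : Measurable (fun s => (polyWeight L e s : ℂ)) :=
    Complex.measurable_ofReal.comp (measurable_polyWeight L e)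
  rw [← eLpNorm_comp_inv μ (fun s => (polyWeight L e s : ℂ) * f s)
    (hw.mul f.continuous.measurable).aestronglyMeasurable]
  simp_rw [polyWeight_inv, ccInv_apply]

variable {μ}

/-- Convolution by `g` on the right is bounded on `L^q(G)`. -/
theorem eLpNorm_groupConv_right_le {L : LengthFunction G} {q : ℝ≥0∞} (h1 : 1 ≤ q) (ht : q ≠ ∞)
    {e : ℝ} {B : NNReal}
    (hB : ∀ f g : C_c(G, ℂ), eLpNorm (groupConv μ f g) q μ ≤
      B * eLpNorm f q (weightedMeasure μ L q e) * eLpNorm g q μ)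
    {x : G → ℂ} (hx : MemLp x q μ) (g : C_c(G, ℂ)) :
    eLpNorm (groupConv μ x g) q μ ≤
      B * eLpNorm g q (weightedMeasure μ L q e) * eLpNorm x q μ := by
  have h0 : q ≠ 0 := (one_pos.trans_le h1).ne'
  have := eLpNorm_groupConv_le_of_cc μ L h1 ht (d := 0) le_rfl (x := x)
    (by rwa [weightedMeasure_zero]) g (r' := q) (B := B * eLpNorm g q (weightedMeasure μ L q e))
    (ENNReal.mul_ne_top ENNReal.coe_ne_top (memLp_weightedMeasure μ L q e g).2.ne) fun h => by
      -- Reflecting `h * g` gives the convolution of the reflected `g` with the reflected `h`, so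
      -- `g` becomes the left factor; its weighted norm is unchanged because the length is
      -- symmetric.
      have h2 := hB (ccInv g) (ccInv h)
      rw [groupConv_eq_reflect, eLpNorm_weightedMeasure_ccInv μ L h0 ht] at h2
      simp only [ccInv_apply, inv_inv] at h2
      have h3 : ccInv (ccInv g) = g := by ext; simp
      rw [h3, eLpNorm_comp_inv μ (groupConv μ h g)
        (continuous_groupConv μ (locallyIntegrable_cc μ h) _).aestronglyMeasurable] at h2
      rw [weightedMeasure_zero]
      exact h2.trans_eq
        (congrArg _ (eLpNorm_comp_inv μ h h.continuous.aestronglyMeasurable q))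
  rwa [weightedMeasure_zero] at this

/-- The longer of `t` and `t⁻¹ s` has at least half the length of `s`. Unlike submultiplicativity,
the sum puts the weight on only one factor at a time. -/
theorem polyWeight_le_add (L : LengthFunction G) {e : ℝ} (he : 0 ≤ e) (s t : G) :
    polyWeight L e s ≤ 2 ^ e * (polyWeight L e t + polyWeight L e (t⁻¹ * s)) := by
  have h := L.map_mul_le' t (t⁻¹ * s)
  rw [mul_inv_cancel_left] at h
  have h1 := L.nonneg' t
  have h2 := L.nonneg' (t⁻¹ * s)
  have h3 := polyWeight_pos L e t
  have h4 := polyWeight_pos L e (t⁻¹ * s)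
  have key : ∀ u : G, 1 + L.toFun s ≤ 2 * (1 + L.toFun u) →
      polyWeight L e s ≤ 2 ^ e * polyWeight L e u := fun u hu => by
    rw [polyWeight, polyWeight, ← Real.mul_rpow zero_le_two (one_add_length_pos L u).le]
    exact Real.rpow_le_rpow (one_add_length_pos L s).le hu he
  have hp : (0 : ℝ) < 2 ^ e := Real.rpow_pos_of_pos zero_lt_two e
  rcases le_total (L.toFun t) (L.toFun (t⁻¹ * s)) with hle | hle
  · exact (key (t⁻¹ * s) (by linarith)).trans
      (mul_le_mul_of_nonneg_left (by linarith) hp.le)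
  · exact (key t (by linarith)).trans (mul_le_mul_of_nonneg_left (by linarith) hp.le)

theorem eLpNorm_weight_mul_norm (L : LengthFunction G) {q : ℝ≥0∞} (h0 : q ≠ 0) (ht : q ≠ ∞)
    (e : ℝ) (f : G → ℂ) :
    eLpNorm (fun t => ((polyWeight L e t * ‖f t‖ : ℝ) : ℂ)) q μ =
      eLpNorm f q (weightedMeasure μ L q e) := by
  rw [eLpNorm_weightedMeasure_eq L μ h0 ht]
  refine eLpNorm_congr_norm_ae (ae_of_all _ fun t => ?_)
  simp

theorem memLp_weight_mul_norm (L : LengthFunction G) {q : ℝ≥0∞} (h0 : q ≠ 0) (ht : q ≠ ∞)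
    (e : ℝ) (f : C_c(G, ℂ)) :
    MemLp (fun t => ((polyWeight L e t * ‖f t‖ : ℝ) : ℂ)) q μ := by
  refine ⟨(Complex.measurable_ofReal.comp
    ((measurable_polyWeight L e).mul f.continuous.measurable.norm)).aestronglyMeasurable, ?_⟩
  rw [eLpNorm_weight_mul_norm L h0 ht]
  exact (memLp_weightedMeasure μ L q e f).2

theorem eLpNorm_ccNormPow_one {α : Measure G} (g : C_c(G, ℂ)) (q : ℝ≥0∞) :
    eLpNorm (ccNormPow g one_pos) q α = eLpNorm g q α := by
  refine eLpNorm_congr_enorm_ae (ae_of_all _ fun t => ?_)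
  rw [enorm_ccNormPow, ENNReal.rpow_one]

/-- The weighted space `L^q(G, ω_e)` is a convolution algebra as soon as it acts on `L^q(G)`. -/
theorem eLpNorm_weightedMeasure_groupConv_le {L : LengthFunction G} {q : ℝ≥0∞} (h1 : 1 ≤ q)
    (ht : q ≠ ∞) {e : ℝ} (he : 0 ≤ e) {B : NNReal}
    (hB : ∀ f g : C_c(G, ℂ), eLpNorm (groupConv μ f g) q μ ≤
      B * eLpNorm f q (weightedMeasure μ L q e) * eLpNorm g q μ) (f g : C_c(G, ℂ)) :
    eLpNorm (groupConv μ f g) q (weightedMeasure μ L q e) ≤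
      ENNReal.ofReal (2 ^ e) * 2 * B * eLpNorm f q (weightedMeasure μ L q e) *
        eLpNorm g q (weightedMeasure μ L q e) := by
  have h0 : q ≠ 0 := (one_pos.trans_le h1).ne'
  set F : G → ℂ := fun t => ((polyWeight L e t * ‖f t‖ : ℝ) : ℂ) with hFdef
  set K : G → ℂ := fun t => ((polyWeight L e t⁻¹ * ‖g t⁻¹‖ : ℝ) : ℂ) with hKdef
  have hF : MemLp F q μ := memLp_weight_mul_norm L h0 ht e f
  have hK : MemLp K q μ := memLp_comp_inv μ (memLp_weight_mul_norm L h0 ht e g)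
  -- `S` is `(ω|f|) * |g|`, and `S'` is the reflection of `|f| * (ω|g|)`. In both, the weighted
  -- factor, which is merely Borel, stands on the left and the continuous one on the right.
  set S : G → ℂ := groupConv μ F (ccNormPow g one_pos)
  set S' : G → ℂ := groupConv μ K (ccNormPow (ccInv f) one_pos)
  have hSc : Continuous S := continuous_groupConv μ (hF.locallyIntegrable h1) _
  have hS'c : Continuous S' := continuous_groupConv μ (hK.locallyIntegrable h1) _
  have hpt : ∀ s, ‖(polyWeight L e s : ℂ) * groupConv μ f g s‖ₑ ≤
      ENNReal.ofReal (2 ^ e) * (‖S s‖ₑ + ‖S' s⁻¹‖ₑ) := by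
    intro s
    have hm : Measurable fun t => ‖g (t⁻¹ * s)‖ₑ :=
      (g.continuous.comp (continuous_inv.mul continuous_const)).measurable.enorm
    have e1 : ‖S s‖ₑ = ∫⁻ t, ENNReal.ofReal (polyWeight L e t) * (‖f t‖ₑ * ‖g (t⁻¹ * s)‖ₑ) ∂μ := by
      rw [enorm_groupConv_of_nonneg μ h1 (u := fun t => polyWeight L e t * ‖f t‖)
        (fun t => mul_nonneg (polyWeight_pos L e t).le (norm_nonneg _)) hF g one_pos]
      refine lintegral_congr fun t => ?_
      rw [ENNReal.ofReal_mul (polyWeight_pos L e t).le, ofReal_norm, ENNReal.rpow_one, mul_assoc]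
    have e2 : ‖S' s⁻¹‖ₑ =
        ∫⁻ t, ENNReal.ofReal (polyWeight L e (t⁻¹ * s)) * (‖f t‖ₑ * ‖g (t⁻¹ * s)‖ₑ) ∂μ := by
      rw [enorm_groupConv_of_nonneg μ h1 (u := fun t => polyWeight L e t⁻¹ * ‖g t⁻¹‖)
        (fun t => mul_nonneg (polyWeight_pos L e _).le (norm_nonneg _)) hK (ccInv f) one_pos,
        ← lintegral_mul_left_eq_self (μ := μ) _ s⁻¹]
      refine lintegral_congr fun t => ?_
      rw [ENNReal.ofReal_mul (polyWeight_pos L e _).le, ofReal_norm, ENNReal.rpow_one, ccInv_apply]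
      simp only [mul_inv_rev, inv_inv, mul_inv_cancel_left]
      rw [mul_assoc, mul_comm ‖f t‖ₑ]
    rw [e1, e2, ← lintegral_add_left, enorm_mul, ← lintegral_const_mul' _ _ ENNReal.ofReal_ne_top]
    · refine (mul_le_mul_right (enorm_groupConv_le μ f g s) _).trans ?_
      rw [← lintegral_const_mul' _ _ enorm_ne_top]
      refine lintegral_mono fun t => ?_
      rw [← add_mul, ← mul_assoc (ENNReal.ofReal (2 ^ e)), ← ofReal_norm, Complex.norm_real,
        Real.norm_of_nonneg (polyWeight_pos L e s).le,
        ← ENNReal.ofReal_add (polyWeight_pos L e _).le (polyWeight_pos L e _).le,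
        ← ENNReal.ofReal_mul (by positivity)]
      gcongr
      exact polyWeight_le_add L he s t
    · exact (measurable_polyWeight L e).ennreal_ofReal.mul (f.continuous.measurable.enorm.mul hm)
  have hS : eLpNorm S q μ ≤ B * eLpNorm f q (weightedMeasure μ L q e) *
      eLpNorm g q (weightedMeasure μ L q e) := by
    refine (eLpNorm_groupConv_right_le h1 ht hB hF _).trans_eq ?_
    rw [eLpNorm_ccNormPow_one, hFdef, eLpNorm_weight_mul_norm L h0 ht]
    ring
  have hS' : eLpNorm S' q μ ≤ B * eLpNorm f q (weightedMeasure μ L q e) *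
      eLpNorm g q (weightedMeasure μ L q e) := by
    refine (eLpNorm_groupConv_right_le h1 ht hB hK _).trans_eq ?_
    rw [eLpNorm_ccNormPow_one, eLpNorm_weightedMeasure_ccInv μ L h0 ht,
      ← eLpNorm_weight_mul_norm L h0 ht e g]
    congr 1
    exact eLpNorm_comp_inv μ _ (memLp_weight_mul_norm L h0 ht e g).1 q
  rw [eLpNorm_weightedMeasure_eq L μ h0 ht]
  calc eLpNorm (fun s => (polyWeight L e s : ℂ) * groupConv μ f g s) q μ
      ≤ ENNReal.ofReal (2 ^ e) * eLpNorm (fun s => (‖S s‖ + ‖S' s⁻¹‖ : ℝ)) q μ := by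
        refine eLpNorm_le_nnreal_smul_eLpNorm_of_ae_le_mul' (ae_of_all _ fun s => ?_) q
        refine (hpt s).trans_eq ?_
        congr 1
        rw [← ofReal_norm (‖S s‖ + ‖S' s⁻¹‖), Real.norm_of_nonneg (by positivity),
          ENNReal.ofReal_add (norm_nonneg _) (norm_nonneg _), ofReal_norm, ofReal_norm]
    _ ≤ ENNReal.ofReal (2 ^ e) * (eLpNorm S q μ + eLpNorm S' q μ) := by
        gcongr
        refine (eLpNorm_add_le hSc.norm.aestronglyMeasurable
          (hS'c.comp continuous_inv).norm.aestronglyMeasurable h1).trans_eq ?_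
        rw [eLpNorm_norm, eLpNorm_norm]
        congr 1
        exact eLpNorm_comp_inv μ S' hS'c.aestronglyMeasurable q
    _ ≤ _ := by
        grw [hS, hS']
        apply le_of_eq
        ring

end Bounds

/-! ### Convolution operators and the extended product -/

section Operators

open Filter Topology

variable {G : Type*} [Group G] [TopologicalSpace G] [IsTopologicalGroup G]
  [LocallyCompactSpace G] [T2Space G] [MeasurableSpace G] [BorelSpace G]
  {μ : Measure G} [μ.IsHaarMeasure] [μ.Regular] [μ.IsMulRightInvariant] [μ.IsInvInvariant]

theorem IsConvOp.unique {r : ℝ≥0∞} [Fact (1 ≤ r)] {f : G → ℂ} {S T : Lp ℂ r μ →L[ℂ] Lp ℂ r μ}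
    (hS : IsConvOp μ f S) (hT : IsConvOp μ f T) : S = T :=
  ContinuousLinearMap.ext fun g => Lp.ext ((hS g).trans (hT g).symm)

theorem exists_isConvOp {r : ℝ≥0∞} [h1 : Fact (1 ≤ r)] (f : C_c(G, ℂ)) {B : NNReal}
    (H : ∀ g : G → ℂ, MemLp g r μ → eLpNorm (groupConv μ f g) r μ ≤ B * eLpNorm g r μ) :
    ∃ T : Lp ℂ r μ →L[ℂ] Lp ℂ r μ, IsConvOp μ f T ∧ ‖T‖ ≤ B := by
  have hm : ∀ g : Lp ℂ r μ, MemLp (groupConv μ f g) r μ := fun g =>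
    ⟨(continuous_groupConv_left μ f h1.out (Lp.memLp g)).aestronglyMeasurable,
      (H g (Lp.memLp g)).trans_lt (ENNReal.mul_lt_top ENNReal.coe_lt_top (Lp.memLp g).2)⟩
  let T : Lp ℂ r μ →ₗ[ℂ] Lp ℂ r μ :=
    { toFun := fun g => (hm g).toLp _
      map_add' := fun g h => by
        rw [← MemLp.toLp_add]
        refine MemLp.toLp_congr _ _ (Eventually.of_forall fun s => ?_)
        rw [groupConv_congr_right μ f (Lp.coeFn_add g h)]
        simp only [groupConv, Pi.add_apply, mul_add]
        exact integral_add (integrable_conv_kernel_left μ f h1.out (Lp.memLp g) s)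
          (integrable_conv_kernel_left μ f h1.out (Lp.memLp h) s)
      map_smul' := fun c g => by
        rw [RingHom.id_apply, ← MemLp.toLp_const_smul]
        refine MemLp.toLp_congr _ _ (Eventually.of_forall fun s => ?_)
        rw [groupConv_congr_right μ f (Lp.coeFn_smul c g)]
        simp only [groupConv, Pi.smul_apply, smul_eq_mul, mul_left_comm _ c]
        exact integral_const_mul _ _ }
  refine ⟨T.mkContinuous B fun g => ?_, fun g => (hm g).coeFn_toLp,
    T.mkContinuous_norm_le B.coe_nonneg _⟩
  have hTg : T g =ᵐ[μ] groupConv μ f g := (hm g).coeFn_toLp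
  rw [Lp.norm_def, Lp.norm_def, eLpNorm_congr_ae hTg, ← ENNReal.coe_toReal,
    ← ENNReal.toReal_mul]
  exact ENNReal.toReal_mono (ENNReal.mul_ne_top ENNReal.coe_ne_top (Lp.memLp g).2.ne)
    (H g (Lp.memLp g))

theorem groupConv_add_left (f f' : C_c(G, ℂ)) {r : ℝ≥0∞} (h1 : 1 ≤ r) {g : G → ℂ}
    (hg : MemLp g r μ) :
    groupConv μ (f + f' : C_c(G, ℂ)) g = groupConv μ f g + groupConv μ f' g := by
  funext s
  simp only [groupConv, CompactlySupportedContinuousMap.coe_add, Pi.add_apply, add_mul]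
  exact integral_add (integrable_conv_kernel_left μ f h1 hg s)
    (integrable_conv_kernel_left μ f' h1 hg s)

theorem groupConv_smul_left (c : ℂ) (f : C_c(G, ℂ)) (g : G → ℂ) :
    groupConv μ (c • f : C_c(G, ℂ)) g = c • groupConv μ f g := by
  funext s
  simp only [groupConv, CompactlySupportedContinuousMap.coe_smul, Pi.smul_apply, smul_eq_mul,
    mul_assoc]
  exact integral_const_mul _ _

theorem groupConv_add_right (f g g' : C_c(G, ℂ)) :
    groupConv μ f (g + g' : C_c(G, ℂ)) = groupConv μ f g + groupConv μ f g' := by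
  have hm : ∀ h : C_c(G, ℂ), MemLp h 1 μ := fun h =>
    h.continuous.memLp_of_hasCompactSupport h.hasCompactSupport
  funext s
  simp only [groupConv, CompactlySupportedContinuousMap.coe_add, Pi.add_apply, mul_add]
  exact integral_add (integrable_conv_kernel_left μ f le_rfl (hm g) s)
    (integrable_conv_kernel_left μ f le_rfl (hm g') s)

theorem groupConv_smul_right (c : ℂ) (f g : C_c(G, ℂ)) :
    groupConv μ f (c • g : C_c(G, ℂ)) = c • groupConv μ f g := by
  funext s
  simp only [groupConv, CompactlySupportedContinuousMap.coe_smul, Pi.smul_apply, smul_eq_mul,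
    mul_left_comm _ c]
  exact integral_const_mul _ _

/-- The convolution operators by compactly supported functions, as a linear map. -/
theorem exists_convOp_linearMap {r : ℝ≥0∞} [h1 : Fact (1 ≤ r)] {N : C_c(G, ℂ) → NNReal}
    (H : ∀ (f : C_c(G, ℂ)) (g : G → ℂ), MemLp g r μ →
      eLpNorm (groupConv μ f g) r μ ≤ N f * eLpNorm g r μ) :
    ∃ T : C_c(G, ℂ) →ₗ[ℂ] (Lp ℂ r μ →L[ℂ] Lp ℂ r μ),
      ∀ f : C_c(G, ℂ), IsConvOp μ f (T f) ∧ ‖T f‖ ≤ N f := by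
  choose T hT hN using fun f : C_c(G, ℂ) => exists_isConvOp f (H f)
  refine ⟨{ toFun := T, map_add' := fun f f' => ?_, map_smul' := fun c f => ?_ },
    fun f => ⟨hT f, hN f⟩⟩
  · refine (hT (f + f')).unique fun g => ?_
    rw [groupConv_add_left f f' h1.out (Lp.memLp g)]
    exact (Lp.coeFn_add _ _).trans ((hT f g).add (hT f' g))
  · refine (hT (c • f)).unique fun g => ?_
    rw [groupConv_smul_left]
    exact (Lp.coeFn_smul _ _).trans ((hT f g).const_smul c)

/-- The inclusion `C_c(G) ⊆ L^r(G, ω_d)` as a linear map. -/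
noncomputable def ccToWeightedLpₗ (μ : Measure G) [μ.IsHaarMeasure] [μ.Regular]
    (L : LengthFunction G) (r : ℝ≥0∞) (d : ℝ) : C_c(G, ℂ) →ₗ[ℂ] WeightedLp μ L r d where
  toFun := ccToWeightedLp μ L r d
  map_add' _ _ := rfl
  map_smul' _ _ := rfl

theorem norm_ccToWeightedLp (L : LengthFunction G) (r : ℝ≥0∞) (d : ℝ) (f : C_c(G, ℂ)) :
    ‖ccToWeightedLp μ L r d f‖ = (eLpNorm f r (weightedMeasure μ L r d)).toReal :=
  Lp.norm_toLp _ _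

/-- Convolution as a bounded bilinear map on `L^q(G, ω_e)`. -/
theorem exists_mul {L : LengthFunction G} {q : ℝ≥0∞} [h1 : Fact (1 ≤ q)] (ht : q ≠ ∞) {e : ℝ}
    (he : 0 ≤ e) {B : NNReal}
    (hB : ∀ f g : C_c(G, ℂ), eLpNorm (groupConv μ f g) q (weightedMeasure μ L q e) ≤
      B * eLpNorm f q (weightedMeasure μ L q e) * eLpNorm g q (weightedMeasure μ L q e)) :
    ∃ M : WeightedLp μ L q e →L[ℂ] WeightedLp μ L q e →L[ℂ] WeightedLp μ L q e,
      ∀ f g : C_c(G, ℂ), M (ccToWeightedLp μ L q e f) (ccToWeightedLp μ L q e g) =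
        ccToWeightedLp μ L q e (ccConv μ f g) := by
  set ι := ccToWeightedLpₗ μ L q e with hι
  have hd : DenseRange ι := denseRange_ccToWeightedLp μ L ht he
  let m : C_c(G, ℂ) → (C_c(G, ℂ) →ₗ[ℂ] WeightedLp μ L q e) := fun f =>
    { toFun := fun g => ι (ccConv μ f g)
      map_add' := fun g g' => by
        rw [← map_add]
        congr 1
        ext s
        exact congrFun (groupConv_add_right f g g') s
      map_smul' := fun c g => by
        rw [RingHom.id_apply, ← map_smul]
        congr 1
        ext s
        exact congrFun (groupConv_smul_right c f g) s }
  have hm : ∀ f g : C_c(G, ℂ), ‖m f g‖ ≤ (B * ‖ι f‖) * ‖ι g‖ := fun f g => by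
    have h2 := hB f g
    change ‖ccToWeightedLp μ L q e (ccConv μ f g)‖ ≤
      (B * ‖ccToWeightedLp μ L q e f‖) * ‖ccToWeightedLp μ L q e g‖
    rw [norm_ccToWeightedLp, norm_ccToWeightedLp, norm_ccToWeightedLp, ← ENNReal.coe_toReal,
      ← ENNReal.toReal_mul, ← ENNReal.toReal_mul]
    exact ENNReal.toReal_mono (ENNReal.mul_ne_top (ENNReal.mul_ne_top ENNReal.coe_ne_top
      (memLp_weightedMeasure μ L q e f).2.ne) (memLp_weightedMeasure μ L q e g).2.ne) h2
  have hme : ∀ f g : C_c(G, ℂ), (m f).extendOfNorm ι (ι g) = ι (ccConv μ f g) := fun f g =>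
    LinearMap.extendOfNorm_eq hd ⟨_, hm f⟩ g
  -- The product has been extended in the second variable for each fixed `f`; linearity in `f`
  -- passes to the extensions by density, and a second extension in `f` follows.
  let m' : C_c(G, ℂ) →ₗ[ℂ] (WeightedLp μ L q e →L[ℂ] WeightedLp μ L q e) :=
    { toFun := fun f => (m f).extendOfNorm ι
      map_add' := fun f f' => by
        refine ContinuousLinearMap.coeFn_injective (hd.equalizer (by fun_prop) (by fun_prop) ?_)
        funext g
        simp only [Function.comp_apply, add_apply, hme, ← map_add]
        congr 1
        ext s
        exact congrFun (groupConv_add_left f f' le_rfl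
          (memLp_one_iff_integrable.2 (integrable_cc μ g))) s
      map_smul' := fun c f => by
        refine ContinuousLinearMap.coeFn_injective (hd.equalizer (by fun_prop) (by fun_prop) ?_)
        funext g
        simp only [Function.comp_apply, smul_apply, hme, RingHom.id_apply,
          ← map_smul]
        congr 1
        ext s
        exact congrFun (groupConv_smul_left c f g) s }
  have hm' : ∀ f, ‖m' f‖ ≤ B * ‖ι f‖ := fun f =>
    LinearMap.opNorm_extendOfNorm_le hd (by positivity) (hm f)
  refine ⟨m'.extendOfNorm ι, fun f g => ?_⟩
  have : m'.extendOfNorm ι (ι f) = m' f := LinearMap.extendOfNorm_eq hd ⟨_, hm'⟩ f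
  change m'.extendOfNorm ι (ι f) (ι g) = ι (ccConv μ f g)
  rw [this]
  exact hme f g

/-- A bilinear extension of convolution is associative. -/
theorem mul_assoc_of_ccConv {L : LengthFunction G} {q : ℝ≥0∞} [h1 : Fact (1 ≤ q)] (ht : q ≠ ∞)
    {e : ℝ} (he : 0 ≤ e)
    {M : WeightedLp μ L q e →L[ℂ] WeightedLp μ L q e →L[ℂ] WeightedLp μ L q e}
    (hM : ∀ f g : C_c(G, ℂ), M (ccToWeightedLp μ L q e f) (ccToWeightedLp μ L q e g) =
        ccToWeightedLp μ L q e (ccConv μ f g)) (x y z : WeightedLp μ L q e) :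
    M (M x y) z = M x (M y z) := by
  have hd : DenseRange (ccToWeightedLp μ L q e) := denseRange_ccToWeightedLp μ L ht he
  refine hd.induction_on₃ (p := fun x y z => M (M x y) z = M x (M y z)) ?_ ?_ x y z
  · exact isClosed_eq (by fun_prop) (by fun_prop)
  · intro f g h
    rw [hM, hM, hM, hM, ccConv_assoc]

end Operators

/-! ### Functions that annihilate `C_c(G)` vanish -/

section Separation

open Filter Topology

variable {G : Type*} [Group G] [TopologicalSpace G] [IsTopologicalGroup G]
  [LocallyCompactSpace G] [T2Space G] [MeasurableSpace G] [BorelSpace G]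
  (μ : Measure G) [μ.IsHaarMeasure] [μ.Regular]

/-- The conjugate phase of `h` need not be continuous. It is replaced by `star h / (|h| + δ)`, whose
product with `h` is at least `|h| - δ`; the error `δ` is integrated only over the compact support,
and `δ → 0`. -/
theorem integral_norm_le_of_integral_mul_le (h : C_c(G, ℂ)) {ε : ℝ}
    (H : ∀ φ : C_c(G, ℂ), (∀ s, ‖φ s‖ ≤ 1) → ‖∫ s, h s * φ s ∂μ‖ ≤ ε) :
    ∫ s, ‖h s‖ ∂μ ≤ ε := by
  have hK : IsCompact (tsupport h) := h.hasCompactSupport.isCompact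
  have hint : Integrable (fun s => ‖h s‖) μ := (integrable_cc μ h).norm
  have key : ∀ δ : ℝ, 0 < δ → ∫ s, ‖h s‖ ∂μ ≤ ε + δ * μ.real (tsupport h) := by
    intro δ hδ
    have hpos : ∀ s, 0 < ‖h s‖ + δ := fun s => by positivity
    let φ : C_c(G, ℂ) := ⟨⟨fun s => star (h s) / ((‖h s‖ + δ : ℝ) : ℂ), by
      refine Continuous.div (by fun_prop) (by fun_prop) fun s => ?_
      exact Complex.ofReal_ne_zero.2 (hpos s).ne'⟩, by
      refine h.hasCompactSupport.mono fun s hs => ?_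
      contrapose! hs
      have : h s = 0 := by simpa using hs
      simp [this]⟩
    have hφ : ∀ s, φ s = star (h s) / ((‖h s‖ + δ : ℝ) : ℂ) := fun _ => rfl
    have hmul : ∀ s, h s * φ s = ((‖h s‖ ^ 2 / (‖h s‖ + δ) : ℝ) : ℂ) := fun s => by
      rw [hφ, ← mul_div_assoc, Complex.ofReal_div, Complex.ofReal_pow]
      congr 1
      exact Complex.mul_conj' (h s)
    have h1 := H φ fun s => by
      rw [hφ, norm_div, norm_star, Complex.norm_real, Real.norm_of_nonneg (hpos s).le,
        div_le_one (hpos s)]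
      linarith
    simp_rw [hmul] at h1
    rw [integral_complex_ofReal, Complex.norm_real] at h1
    have h2 := (le_abs_self _).trans h1
    have hint2 : Integrable (fun s => ‖h s‖ ^ 2 / (‖h s‖ + δ)) μ := by
      refine hint.mono' ?_ (ae_of_all _ fun s => ?_)
      · exact (Continuous.div (by fun_prop) (by fun_prop)
          fun s => (hpos s).ne').aestronglyMeasurable
      · rw [Real.norm_of_nonneg (div_nonneg (by positivity) (hpos s).le), div_le_iff₀ (hpos s)]
        nlinarith [norm_nonneg (h s)]
    have hint3 : Integrable ((tsupport h).indicator fun _ => δ) μ :=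
      (integrable_indicator_iff hK.measurableSet).2 (integrableOn_const hK.measure_lt_top.ne)
    have h3 : ∫ s, ‖h s‖ ∂μ ≤
        ∫ s, (‖h s‖ ^ 2 / (‖h s‖ + δ) + (tsupport h).indicator (fun _ => δ) s) ∂μ := by
      refine integral_mono hint (hint2.add hint3) fun s => ?_
      by_cases hs : s ∈ tsupport h
      · simp only [hs, Set.indicator_of_mem]
        rw [div_add' _ _ _ (hpos s).ne', le_div_iff₀ (hpos s)]
        nlinarith [norm_nonneg (h s)]
      · simp [hs, image_eq_zero_of_notMem_tsupport hs]
    rw [integral_add hint2 hint3, integral_indicator hK.measurableSet, setIntegral_const,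
      smul_eq_mul, mul_comm] at h3
    linarith
  have hlim : Tendsto (fun δ : ℝ => ε + δ * μ.real (tsupport h)) (𝓝[>] 0) (𝓝 ε) := by
    have : Continuous (fun δ : ℝ => ε + δ * μ.real (tsupport h)) := by fun_prop
    simpa using (this.tendsto 0).mono_left nhdsWithin_le_nhds
  exact ge_of_tendsto hlim (eventually_nhdsWithin_of_forall fun δ hδ => key δ hδ)

/-- If `h` in `C_c(G)` is `L¹`-close to `y`, then `∫ h φ = -∫ (y - h) φ` is small for all `|φ| ≤ 1`.
Hence `h` has small `L¹` norm, and so does `y`. -/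
theorem ae_eq_zero_of_integral_mul_cc_eq_zero_of_integrable {y : G → ℂ} (hy : Integrable y μ)
    (H : ∀ φ : C_c(G, ℂ), ∫ s, y s * φ s ∂μ = 0) : y =ᵐ[μ] 0 := by
  rw [← eLpNorm_eq_zero_iff hy.1 one_ne_zero, ← nonpos_iff_eq_zero]
  refine ENNReal.le_of_forall_pos_le_add fun ε hε _ => ?_
  rw [zero_add]
  have hε2 : ((ε / 2 : NNReal) : ℝ≥0∞) ≠ 0 := by simpa using hε.ne'
  obtain ⟨h, hh⟩ := exists_cc_eLpNorm_sub_le μ ENNReal.one_ne_top (memLp_one_iff_integrable.2 hy)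
    hε2
  have hsub : Integrable (y - ⇑h) μ := hy.sub (integrable_cc μ h)
  have hsub' : ∫ s, ‖(y - ⇑h) s‖ ∂μ ≤ (ε / 2 : NNReal) := by
    rw [eLpNorm_one_eq_lintegral_enorm, ← ofReal_integral_norm_eq_lintegral_enorm hsub,
      ENNReal.ofReal_le_iff_le_toReal ENNReal.coe_ne_top] at hh
    simpa using hh
  have h1 := integral_norm_le_of_integral_mul_le μ h (ε := (ε / 2 : NNReal)) fun φ hφ => by
    have hi1 : Integrable (fun s => y s * φ s) μ := by
      refine hy.norm.mono' (hy.1.mul φ.continuous.aestronglyMeasurable) (ae_of_all _ fun s => ?_)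
      rw [norm_mul]
      exact mul_le_of_le_one_right (norm_nonneg _) (hφ s)
    have hi2 : Integrable (fun s => h s * φ s) μ := by
      refine (integrable_cc μ h).norm.mono'
        (h.continuous.mul φ.continuous).aestronglyMeasurable (ae_of_all _ fun s => ?_)
      rw [norm_mul]
      exact mul_le_of_le_one_right (norm_nonneg _) (hφ s)
    have e1 : ∫ s, h s * φ s ∂μ = -∫ s, (y - ⇑h) s * φ s ∂μ := by
      simp_rw [Pi.sub_apply, sub_mul]
      rw [integral_sub hi1 hi2, H φ, zero_sub, neg_neg]
    rw [e1, norm_neg]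
    refine (norm_integral_le_of_norm_le hsub.norm (ae_of_all _ fun s => ?_)).trans hsub'
    rw [norm_mul]
    exact mul_le_of_le_one_right (norm_nonneg _) (hφ s)
  have h2 : eLpNorm h 1 μ ≤ (ε / 2 : NNReal) := by
    rw [eLpNorm_one_eq_lintegral_enorm,
      ← ofReal_integral_norm_eq_lintegral_enorm (integrable_cc μ h),
      ENNReal.ofReal_le_iff_le_toReal ENNReal.coe_ne_top]
    simpa using h1
  calc eLpNorm y 1 μ = eLpNorm ((y - ⇑h) + ⇑h) 1 μ := by rw [sub_add_cancel]
    _ ≤ eLpNorm (y - ⇑h) 1 μ + eLpNorm h 1 μ :=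
        eLpNorm_add_le hsub.1 h.continuous.aestronglyMeasurable le_rfl
    _ ≤ (ε / 2 : NNReal) + (ε / 2 : NNReal) := add_le_add hh h2
    _ = ε := by rw [← ENNReal.coe_add, add_halves]

/-- An `L^r` function that annihilates all compactly supported continuous functions vanishes. -/
theorem ae_eq_zero_of_integral_mul_cc_eq_zero {r : ℝ≥0∞} (h1 : 1 ≤ r) (ht : r ≠ ∞) {x : G → ℂ}
    (hx : MemLp x r μ) (H : ∀ φ : C_c(G, ℂ), ∫ s, x s * φ s ∂μ = 0) : x =ᵐ[μ] 0 := by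
  rw [← eLpNorm_eq_zero_iff hx.1 (one_pos.trans_le h1).ne', ← nonpos_iff_eq_zero]
  refine ENNReal.le_of_forall_pos_le_add fun ε hε _ => ?_
  rw [zero_add]
  obtain ⟨h, hh⟩ := exists_cc_eLpNorm_sub_le μ ht hx (ENNReal.coe_pos.2 hε).ne'
  obtain ⟨ψ, hψ1, -, hψc, -⟩ := exists_continuous_one_zero_of_isCompact
    h.hasCompactSupport.isCompact isClosed_empty (Set.disjoint_empty _)
  have hxψ : Integrable (fun s => ψ s • x s) μ :=
    (hx.locallyIntegrable h1).integrable_smul_left_of_hasCompactSupport ψ.continuous hψc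
  have h0 := ae_eq_zero_of_integral_mul_cc_eq_zero_of_integrable μ hxψ fun φ => by
    let φ' : C_c(G, ℂ) := ⟨⟨fun s => (ψ s : ℂ) * φ s, by fun_prop⟩, φ.hasCompactSupport.mul_left⟩
    rw [← H φ']
    refine integral_congr_ae (ae_of_all _ fun s => ?_)
    change ψ s • x s * φ s = x s * (ψ s * φ s)
    rw [Complex.real_smul]
    ring
  -- The integrable case, applied to `ψ x`, makes `x` vanish almost everywhere on the support of
  -- `h`; off it `x = x - h`. So `|x| ≤ |x - h|` almost everywhere, and no σ-finiteness enters.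
  refine le_trans (eLpNorm_mono_ae ?_) hh
  filter_upwards [h0] with s hs
  by_cases hsh : s ∈ tsupport h
  · have h2 : ψ s = 1 := hψ1 hsh
    have h3 : x s = 0 := by simpa [h2] using hs
    simp [h3]
  · simp [image_eq_zero_of_notMem_tsupport hsh]

end Separation

/-! ### Injectivity, the map to pseudofunctions, and the theorem -/

section Main

open Filter Topology

variable {G : Type*} [Group G] [TopologicalSpace G] [IsTopologicalGroup G]
  [LocallyCompactSpace G] [T2Space G] [MeasurableSpace G] [BorelSpace G]
  {μ : Measure G} [μ.IsHaarMeasure] [μ.Regular]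

/-- A bounded map that extends `f ↦ λ_q(f)` to `L^q(G, ω_e)` is injective. -/
theorem eq_zero_of_convOp_eq_zero {L : LengthFunction G} {q : ℝ≥0∞} [h1 : Fact (1 ≤ q)]
    (ht : q ≠ ∞) {e : ℝ} (he : 0 ≤ e)
    {T : WeightedLp μ L q e →L[ℂ] (Lp ℂ q μ →L[ℂ] Lp ℂ q μ)}
    (hT : ∀ f : C_c(G, ℂ), IsConvOp μ f (T (ccToWeightedLp μ L q e f)))
    {x : WeightedLp μ L q e} (hx : T x = 0) : x = 0 := by
  obtain ⟨h, hh⟩ := exists_seq_cc_tendsto μ L h1.out ht he (Lp.memLp x)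
  have hxμ : MemLp x q μ := memLp_of_weightedMeasure he (Lp.memLp x)
  have hm : ∀ n, MemLp (h n) q μ := fun n =>
    (h n).continuous.memLp_of_hasCompactSupport (h n).hasCompactSupport
  have hhμ : Tendsto (fun n => eLpNorm (⇑x - ⇑(h n)) q μ) atTop (𝓝 0) :=
    tendsto_of_tendsto_of_tendsto_of_le_of_le tendsto_const_nhds hh (fun _ => zero_le)
      fun n => eLpNorm_le_eLpNorm_weightedMeasure L μ q he _
  have hconv : ∀ g : C_c(G, ℂ), groupConv μ x g = 0 := by
    intro g
    have hg : MemLp g q μ := g.continuous.memLp_of_hasCompactSupport g.hasCompactSupport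
    have hc := continuous_groupConv μ (hxμ.locallyIntegrable h1.out) g
    rw [← hc.ae_eq_iff_eq μ continuous_zero,
      ← eLpNorm_eq_zero_iff hc.aestronglyMeasurable (one_pos.trans_le h1.out).ne',
      ← nonpos_iff_eq_zero]
    -- Along `h n → x` the operators converge to `T x = 0`, while `h n * g → x * g` pointwise;
    -- Fatou's lemma then gives `x * g = 0`.
    have hlim : Tendsto (fun n => ‖T (ccToWeightedLp μ L q e (h n)) (hg.toLp g)‖ₑ) atTop
        (𝓝 0) := by
      have hcont : Continuous fun y => ‖T y (hg.toLp g)‖ₑ := by fun_prop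
      have := (hcont.tendsto x).comp (tendsto_ccToWeightedLp hh)
      simpa [hx, Function.comp_def] using this
    refine ENNReal.le_of_forall_pos_le_add fun ε hε _ => ?_
    rw [zero_add]
    refine Lp.eLpNorm_le_of_ae_tendsto (f := fun n => groupConv μ (h n) g) (u := atTop) ?_
      (fun n => (continuous_groupConv μ (locallyIntegrable_cc μ (h n)) g).aestronglyMeasurable)
      (ae_of_all _ fun s => tendsto_groupConv μ h1.out hxμ hm hhμ g s)
    filter_upwards [hlim.eventually (ge_mem_nhds (ENNReal.coe_pos.2 hε))] with n hn
    have h2 := hT (h n) (hg.toLp g)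
    rw [groupConv_congr_right μ (h n) hg.coeFn_toLp] at h2
    rwa [← eLpNorm_congr_ae h2, ← Lp.enorm_def]
  -- The value at `1` of the convolution of `x` with the reflection of `φ` is `∫ x φ`.
  have h0 : x =ᵐ[μ] 0 := ae_eq_zero_of_integral_mul_cc_eq_zero μ h1.out ht hxμ fun φ => by
    have := congrFun (hconv (ccInv φ)) 1
    simpa [groupConv] using this
  exact Lp.ext (((weightedMeasure_absolutelyContinuous L μ q e).ae_eq h0).trans
    (Lp.coeFn_zero _ _ _).symm)

theorem isConvOp_mem_symPseudofunctions {p q : ℝ≥0∞} [Fact (1 ≤ p)] [Fact (1 ≤ q)]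
    (f : C_c(G, ℂ)) {T : (Lp ℂ p μ →L[ℂ] Lp ℂ p μ) × (Lp ℂ q μ →L[ℂ] Lp ℂ q μ)}
    (h1 : IsConvOp μ f T.1) (h2 : IsConvOp μ f T.2) : T ∈ symPseudofunctions μ p q :=
  NonUnitalSubalgebra.le_topologicalClosure _
    (NonUnitalAlgebra.subset_adjoin ℂ ⟨f, integrable_cc μ f, h1, h2⟩)

/-- The inclusion of `L^q(G, ω_e)` in the symmetrized pseudofunctions. -/
theorem exists_injective_to_symPseudofunctions [μ.IsMulRightInvariant] [μ.IsInvInvariant]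
    {L : LengthFunction G} {p q : ℝ≥0∞} [Fact (1 ≤ p)] [Fact (1 ≤ q)]
    (ht : q ≠ ∞) {e : ℝ} (he : 0 ≤ e) {B : NNReal}
    (hp : ∀ (f : C_c(G, ℂ)) (g : G → ℂ), MemLp g p μ → eLpNorm (groupConv μ f g) p μ ≤
      B * eLpNorm f q (weightedMeasure μ L q e) * eLpNorm g p μ)
    (hq : ∀ (f : C_c(G, ℂ)) (g : G → ℂ), MemLp g q μ → eLpNorm (groupConv μ f g) q μ ≤
      B * eLpNorm f q (weightedMeasure μ L q e) * eLpNorm g q μ) :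
    ∃ J : WeightedLp μ L q e →L[ℂ] symPseudofunctions μ p q,
      Function.Injective J ∧
      ∀ f : C_c(G, ℂ),
        IsConvOp μ f (J (ccToWeightedLp μ L q e f)).1.1 ∧
        IsConvOp μ f (J (ccToWeightedLp μ L q e f)).1.2 := by
  set ι := ccToWeightedLpₗ μ L q e with hι
  have hd : DenseRange ι := denseRange_ccToWeightedLp μ L ht he
  let N : C_c(G, ℂ) → NNReal := fun f => B * ‖ι f‖₊
  have hN : ∀ f : C_c(G, ℂ), (N f : ℝ≥0∞) = B * eLpNorm f q (weightedMeasure μ L q e) :=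
    fun f => by
      rw [ENNReal.coe_mul, ← enorm_eq_nnnorm]
      exact congrArg _ (Lp.enorm_toLp (memLp_weightedMeasure μ L q e f))
  obtain ⟨S, hS⟩ := exists_convOp_linearMap (μ := μ) (r := p) (N := N)
    fun f g hg => by rw [hN]; exact hp f g hg
  obtain ⟨T, hT⟩ := exists_convOp_linearMap (μ := μ) (r := q) (N := N)
    fun f g hg => by rw [hN]; exact hq f g hg
  let Φ := S.prod T
  have hΦ : ∀ f, ‖Φ f‖ ≤ B * ‖ι f‖ := fun f => max_le (hS f).2 (hT f).2
  let J₀ := Φ.extendOfNorm ι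
  have hJ₀ : ∀ f, J₀ (ι f) = Φ f := fun f => LinearMap.extendOfNorm_eq hd ⟨_, hΦ⟩ f
  have hmem : ∀ x, J₀ x ∈ symPseudofunctions μ p q := fun x => by
    refine hd.induction_on (p := fun x => J₀ x ∈ symPseudofunctions μ p q) x ?_ fun f => ?_
    · exact (NonUnitalSubalgebra.isClosed_topologicalClosure _).preimage J₀.continuous
    · rw [hJ₀]
      exact isConvOp_mem_symPseudofunctions f (hS f).1 (hT f).1
  let J : WeightedLp μ L q e →L[ℂ] symPseudofunctions μ p q :=
    { toFun := fun x => ⟨J₀ x, hmem x⟩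
      map_add' := fun x y => Subtype.ext (map_add J₀ x y)
      map_smul' := fun c x => Subtype.ext (map_smul J₀ c x)
      cont := J₀.continuous.subtype_mk _ }
  refine ⟨J, ?_, fun f => ?_⟩
  · intro x y hxy
    have hJ : J₀ x = J₀ y := congrArg Subtype.val hxy
    refine sub_eq_zero.1 ?_
    -- The second coordinate, acting on `L^q(G)`, already separates points.
    refine eq_zero_of_convOp_eq_zero ht he
      (T := (ContinuousLinearMap.snd ℂ _ _).comp J₀) (fun f => ?_) ?_
    · change IsConvOp μ f (J₀ (ι f)).2
      rw [hJ₀]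
      exact (hT f).1
    · rw [map_sub, ContinuousLinearMap.comp_apply, ContinuousLinearMap.comp_apply, hJ, sub_self]
  · change IsConvOp μ f (J₀ (ι f)).1 ∧ IsConvOp μ f (J₀ (ι f)).2
    rw [hJ₀]
    exact ⟨(hS f).1, (hT f).1⟩

/-- The infimum only yields some admissible `d'` below `d`. Admissibility of `d` itself is never
needed, since the interpolation tolerates `d' ≤ d`. -/
theorem exists_bound_of_rapidDecayDegree_lt {L : LengthFunction G} (hRD : HasRapidDecay μ L)
    {d : ℝ} (hd : rapidDecayDegree μ L < d) :
    ∃ d', 0 ≤ d' ∧ d' ≤ d ∧ ∃ C : NNReal, ∀ f g : C_c(G, ℂ), eLpNorm (groupConv μ f g) 2 μ ≤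
      C * eLpNorm f 2 (weightedMeasure μ L 2 d') * eLpNorm g 2 μ := by
  obtain ⟨d₀, hd₀, h₀⟩ := hRD
  rw [rapidDecayDegree] at hd
  have hne : {d : ℝ | 0 ≤ d ∧ L2IncludedInReduced μ L d}.Nonempty := ⟨d₀, hd₀.le, h₀⟩
  obtain ⟨d', ⟨hd'0, hd'⟩, hlt⟩ := exists_lt_of_csInf_lt hne hd
  exact ⟨d', hd'0, hlt.le, hd'.exists_bound⟩

end Main

theorem theoremT {G : Type*} [Group G] [TopologicalSpace G] [IsTopologicalGroup G]
    [LocallyCompactSpace G] [T2Space G] [MeasurableSpace G] [BorelSpace G]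
    (μ : Measure G) [μ.IsHaarMeasure] [μ.Regular]
    (L : LengthFunction G) (hRD : HasRapidDecay μ L)
    (d : ℝ) (hd : rapidDecayDegree μ L < d)
    (p q : ℝ≥0∞) [Fact (1 ≤ p)] [Fact (1 ≤ q)] (hqp : q ≤ p) (hpq : p⁻¹ + q⁻¹ = 1) :
    (∃ M : WeightedLp μ L q (2 * d * p⁻¹.toReal) →L[ℂ]
          WeightedLp μ L q (2 * d * p⁻¹.toReal) →L[ℂ] WeightedLp μ L q (2 * d * p⁻¹.toReal),
      (∀ f g : C_c(G, ℂ),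
        M (ccToWeightedLp μ L q (2 * d * p⁻¹.toReal) f)
          (ccToWeightedLp μ L q (2 * d * p⁻¹.toReal) g) =ᵐ[μ] groupConv μ f g) ∧
      ∀ x y z : WeightedLp μ L q (2 * d * p⁻¹.toReal), M (M x y) z = M x (M y z)) ∧
    ∃ J : WeightedLp μ L q (2 * d * p⁻¹.toReal) →L[ℂ] symPseudofunctions μ p q,
      Function.Injective J ∧
      ∀ f : C_c(G, ℂ),
        IsConvOp μ f (J (ccToWeightedLp μ L q (2 * d * p⁻¹.toReal) f)).1.1 ∧
        IsConvOp μ f (J (ccToWeightedLp μ L q (2 * d * p⁻¹.toReal) f)).1.2 := by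
  obtain ⟨d', hd'0, hd'd, C, hC⟩ := exists_bound_of_rapidDecayDegree_lt hRD hd
  have hr : μ.IsMulRightInvariant := isMulRightInvariant_of_rapidDecay hd'0 hC
  have hi : μ.IsInvInvariant := isInvInvariant_of_isMulRightInvariant μ
  have hp1 : 1 ≤ p := Fact.out
  have hq1 : 1 ≤ q := Fact.out
  have hp0 : p ≠ 0 := (one_pos.trans_le hp1).ne'
  have hq0 : q ≠ 0 := (one_pos.trans_le hq1).ne'
  have hqt : q ≠ ∞ := by
    rintro rfl
    rw [top_le_iff] at hqp
    simp [hqp] at hpq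
  have hsum : p⁻¹.toReal + q⁻¹.toReal = 1 := by
    rw [← ENNReal.toReal_add (ENNReal.inv_ne_top.2 hp0) (ENNReal.inv_ne_top.2 hq0), hpq,
      ENNReal.toReal_one]
  have hle : p⁻¹.toReal ≤ q⁻¹.toReal :=
    ENNReal.toReal_mono (ENNReal.inv_ne_top.2 hq0) (ENNReal.inv_le_inv.2 hqp)
  have hp0' : 0 ≤ p⁻¹.toReal := ENNReal.toReal_nonneg
  rw [show 2 * d * p⁻¹.toReal = d * (2 * p⁻¹.toReal) by ring]
  -- The interpolation parameter `2/p`; it is `0` for `p = ∞`, and `q ≤ p` gives `θ ≤ 1`.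
  set θ := 2 * p⁻¹.toReal with hθ
  have hθ0 : 0 ≤ θ := by positivity
  have hθ1 : θ ≤ 1 := by linarith
  have hqθ : q.toReal * (1 - θ / 2) = 1 := by
    rw [show 1 - θ / 2 = q⁻¹.toReal by linarith, ← ENNReal.toReal_mul,
      ENNReal.mul_inv_cancel hq0 hqt, ENNReal.toReal_one]
  have he : 0 ≤ d * θ := mul_nonneg (hd'0.trans hd'd) hθ0
  have hCθ : ((C ^ θ : NNReal) : ℝ≥0∞) = (C : ℝ≥0∞) ^ θ :=
    ENNReal.coe_rpow_of_nonneg _ hθ0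
  have hBt : ∀ f : C_c(G, ℂ),
      ((C ^ θ : NNReal) : ℝ≥0∞) * eLpNorm f q (weightedMeasure μ L q (d * θ)) ≠ ∞ := fun f =>
    ENNReal.mul_ne_top ENNReal.coe_ne_top (memLp_weightedMeasure μ L q _ f).2.ne
  have hBq : ∀ f g : C_c(G, ℂ), eLpNorm (groupConv μ f g) q μ ≤
      (C ^ θ : NNReal) * eLpNorm f q (weightedMeasure μ L q (d * θ)) * eLpNorm g q μ := by
    rw [hCθ]
    exact eLpNorm_groupConv_le_of_le_two hd'0 hd'd hC hθ0 hθ1 hq0 hqt hqθ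
  refine ⟨?_, exists_injective_to_symPseudofunctions hqt he (B := C ^ θ) ?_ ?_⟩
  · obtain ⟨M, hM⟩ := exists_mul (μ := μ) hqt he (B := (2 ^ (d * θ) : ℝ).toNNReal * 2 * C ^ θ)
      (L := L) fun f g => by
        push_cast
        exact eLpNorm_weightedMeasure_groupConv_le hq1 hqt he hBq f g
    refine ⟨M, fun f g => ?_, mul_assoc_of_ccConv hqt he hM⟩
    rw [hM]
    exact (absolutelyContinuous_weightedMeasure L μ q _).ae_eq (MemLp.coeFn_toLp _)
  · intro f g hg
    -- For `p = ∞` one has `θ = 0` and `q = 1`, so the weight and the constant disappear and the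
    -- trivial bound applies.
    by_cases hpt : p = ∞
    · subst hpt
      have hθz : θ = 0 := by simp [hθ]
      have hq : q = 1 := by simpa using hpq
      subst hq
      rw [hθz, NNReal.rpow_zero, mul_zero, weightedMeasure_zero, ENNReal.coe_one, one_mul]
      exact eLpNorm_top_groupConv_le μ f g
    · have hpθ : p.toReal * θ = 2 := by
        rw [hθ, mul_left_comm, ← ENNReal.toReal_mul, ENNReal.mul_inv_cancel hp0 hpt,
          ENNReal.toReal_one, mul_one]
      refine eLpNorm_groupConv_left_le_of_cc μ L hp1 hpt f (hBt f) (fun g => ?_) hg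
      rw [hCθ]
      exact eLpNorm_groupConv_le_of_two_le hd'0 hd'd hC hθ0 hθ1 hq0 hqt hqθ hp0 hpt hpθ f g
  · intro f g hg
    exact eLpNorm_groupConv_left_le_of_cc μ L hq1 hqt f (hBt f) (hBq f) hg
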